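/- Let $\ell^2=\ell^2(\mathbb Z)$ be the Hilbert space of square-summable functions $\mathbb Z\to\mathbb C$, with shifts $(S_\tau\psi)(t)=\psi(t-\tau)$, $\tau\in\mathbb Z$, and let $\delta\in\ell^2$ be the function with $\delta(0)=1$ and $\delta(t)=0$ for $t\ne 0$. The discrete-time Fourier transform of $\psi\in\ell^2$ is the $2\pi$-periodic function $\mathcal F_d[\psi](\omega)=\sum_{t\in\mathbb Z}\psi(t)e^{-i\omega t}$, where the series converges in the mean-square sense over a period; it is determined for almost every $\omega\in\mathbb R$. For finite sets $A,B$, a bounded linear map $D:\bigoplus_A\ell^2\to\bigoplus_B\ell^2$ is *linear shift-invariant* (LSI) if every component $\pi_bD\iota_a:\ell^2\to\ell^2$ commutes with all shifts. It is represented by the family of matrices $\widehat D_\omega=\big(\mathcal F_d[(\pi_bD\iota_a)\delta](\omega)\big)_{b\in B,a\in A}:\mathbb C^A\to\mathbb C^B$, $\omega\in\mathbb R$. The category $\mathbf{LSI}_\le$ has finite sets as objects. A morphism $f:A\to B$ is a family $\{\widehat f_\omega:\mathbb C^A\to\mathbb C^B\}_{\omega\in\mathbb R}$, taken up to equality for almost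 every $\omega$, that represents an LSI map $\bigoplus_A\ell^2\to\bigoplus_B\ell^2$ and for which $\widehat f_\omega$ is a contraction for the Euclidean norms, for almost every $\omega$. Composition and identities are computed at each $\omega$. The category is symmetric monoidal with $\oplus$ the disjoint union on objects and the direct sum at each $\omega$ on morphisms; the unit is $\varnothing$, and the associators $\alpha$, unitors $\lambda,\rho$ and symmetries $\sigma$ come from the evident bijections of sets. For a countable family $\{f_i\}_{i\in I}$ of morphisms $A\to B$ and a morphism $g:A\to B$, write $\Sigma\{f_i\}_{i\in I}=g$ if, for almost every $\omega$, the net of finite partial sums of $\{\widehat{(f_i)}_\omega\}_{i\in I}$ converges to $\widehat g_\omega$. For $f:A\oplus U\to B\oplus U$ let $f_{BA}:A\to B$, $f_{BU}:U\to B$, $f_{UA}:A\to U$, $f_{UU}:U\to U$ be its components $\pi_Yf\iota_X$, where the injections and projections are built from identities, zero morphisms and the unitors. **Theorem.** For all finite sets $A,B,U$ and every $f:A\oplus U\to B\oplus U$ in $\mathbf{LSI}_\le$ there is exactly one morphism $\mathrm{ex}^U(f):A\to B$ of $\mathbf{LSI}_\le$ with $$\mathrm{ex}^U(f)=\Sigma\big(\{f_{BA}\}\uplus\{f_{BU}f_{UU}^nf_{UA}\}_{n\in\mathbb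 N}\big),$$ and every LSI map $\bigoplus_A\ell^2\to\bigoplus_B\ell^2$ that $\mathrm{ex}^U(f)$ represents is a contraction. Moreover $(\mathbf{LSI}_\le,\oplus,\mathrm{ex})$ is a totally traced symmetric monoidal category, that is, $\mathrm{ex}$ satisfies * naturality: $h\,\mathrm{ex}^U(f)\,g=\mathrm{ex}^U\big((h\oplus\mathrm{id}_U)f(g\oplus\mathrm{id}_U)\big)$ for $f:A\oplus U\to B\oplus U$, $g:A'\to A$, $h:B\to B'$; * dinaturality: $\mathrm{ex}^U\big((\mathrm{id}_B\oplus g)f\big)=\mathrm{ex}^{U'}\big(f(\mathrm{id}_A\oplus g)\big)$ for $f:A\oplus U\to B\oplus U'$ and $g:U'\to U$; * superposing: $g\oplus\mathrm{ex}^U(f)=\mathrm{ex}^U\big(\alpha^{-1}(g\oplus f)\alpha\big)$ for $g:D\to E$ and $f:A\oplus U\to B\oplus U$; * vanishing: $\mathrm{ex}^{\varnothing}(f)=\rho_Bf\rho_A^{-1}$ for $f:A\oplus\varnothing\to B\oplus\varnothing$, and $\mathrm{ex}^U(\mathrm{ex}^V(f))=\mathrm{ex}^{U\oplus V}(\alpha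 f\alpha^{-1})$ for $f:(A\oplus U)\oplus V\to(B\oplus U)\oplus V$; * yanking: $\mathrm{ex}^U(\sigma_{U,U})=\mathrm{id}_U$. -/

import Mathlib

open CategoryTheory MonoidalCategory MeasureTheory
open scoped Real

universe u v

noncomputable section

namespace LSI

/-- The Hilbert space of square-summable functions `ℤ → ℂ`. -/
abbrev EllTwo : Type := lp (fun _ : ℤ => ℂ) 2

/-- The unit `δ` of the convolution. -/
def delta : EllTwo := lp.single 2 0 1

lemma memlp_shift (τ : ℤ) (ψ : EllTwo) : Memℓp (fun t : ℤ => ψ (t - τ)) 2 := by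
  have h := lp.memℓp ψ
  rw [memℓp_gen_iff (by norm_num)] at h ⊢
  exact (Equiv.subRight τ).summable_iff.2 h

/-- The shift operator `S_τ`, `(S_τ ψ)(t) = ψ(t - τ)`. -/
def shift (τ : ℤ) (ψ : EllTwo) : EllTwo := ⟨fun t => ψ (t - τ), memlp_shift τ ψ⟩

instance instTwoPiPos : Fact (0 < 2 * π) := ⟨Real.two_pi_pos⟩

lemma quasiMeasurePreserving_coe :
    Measure.QuasiMeasurePreserving (fun ω : ℝ => (ω : AddCircle (2 * π))) volume
      AddCircle.haarAddCircle := by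
  refine ⟨AddCircle.measurable_mk', ?_⟩
  refine Measure.AbsolutelyContinuous.mk fun s hs h0 => ?_
  rw [Measure.map_apply AddCircle.measurable_mk' hs]
  have h1 : (volume : Measure (AddCircle (2 * π))) s = 0 := by
    rw [AddCircle.volume_eq_smul_haarAddCircle]; simp [h0]
  have h2 : ∀ n : ℤ, volume ((fun ω : ℝ => (ω : AddCircle (2 * π))) ⁻¹' s ∩
      Set.Ioc (0 + n • (2 * π)) (0 + (n + 1) • (2 * π))) = 0 := by
    intro n
    have hp := AddCircle.measurePreserving_mk (2 * π) (n • (2 * π))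
    have := hp.measure_preimage hs.nullMeasurableSet
    rw [h1, Measure.restrict_apply (AddCircle.measurable_mk' hs)] at this
    convert! this using 3
    · rw [zero_add, zero_add, add_smul, one_smul]
  have h3 := iUnion_Ioc_add_zsmul Real.two_pi_pos 0
  rw [← Set.inter_univ ((fun ω : ℝ => (ω : AddCircle (2 * π))) ⁻¹' s), ← h3, Set.inter_iUnion]
  exact measure_iUnion_null h2

/-- Functions of the frequency `ω ∈ ℝ`, measurable and taken up to equality almost everywhere.
The DTFT of a square-summable function is only determined almost everywhere. -/
abbrev Freq : Type := ℝ →ₘ[volume] ℂ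

instance instCommRingFreq : CommRing Freq :=
  { (inferInstance : AddCommGroup Freq), (inferInstance : CommMonoid Freq) with
    left_distrib := fun a b c => AEEqFun.toGerm_injective (by
      simp only [AEEqFun.mul_toGerm, AEEqFun.add_toGerm, mul_add])
    right_distrib := fun a b c => AEEqFun.toGerm_injective (by
      simp only [AEEqFun.mul_toGerm, AEEqFun.add_toGerm, add_mul])
    zero_mul := fun a => AEEqFun.toGerm_injective (by
      simp only [AEEqFun.mul_toGerm, AEEqFun.zero_toGerm, zero_mul])
    mul_zero := fun a => AEEqFun.toGerm_injective (by
      simp only [AEEqFun.mul_toGerm, AEEqFun.zero_toGerm, mul_zero]) }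

/-- The orthonormal basis `ω ↦ e^{-iωt}`, `t ∈ ℤ`, of square-integrable functions on a period,
for the normalised measure `dω / 2π`. -/
def expBasis : HilbertBasis ℤ ℂ (Lp ℂ 2 (AddCircle.haarAddCircle (T := 2 * π))) :=
  HilbertBasis.mk (v := fun t : ℤ => fourierLp 2 (-t))
    (orthonormal_fourier.comp _ neg_injective)
    (by
      have h : Set.range (fun t : ℤ => fourierLp (T := 2 * π) 2 (-t)) =
          Set.range (fourierLp (T := 2 * π) 2) :=
        (Equiv.neg ℤ).surjective.range_comp (fourierLp (T := 2 * π) 2)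
      rw [h]
      exact (span_fourierLp_closure_eq_top (by norm_num)).ge)

/-- The discrete-time Fourier transform `∑ₜ f(t) e^{-iωt}`, as a square-integrable function on a
period; the series converges in the mean-square sense, see `hasSum_dtftCircle`. -/
def dtftCircle : EllTwo ≃ₗᵢ[ℂ] Lp ℂ 2 (AddCircle.haarAddCircle (T := 2 * π)) :=
  expBasis.repr.symm

lemma hasSum_dtftCircle (f : EllTwo) :
    HasSum (fun t : ℤ => f t • fourierLp (T := 2 * π) 2 (-t)) (dtftCircle f) := by
  have := expBasis.hasSum_repr_symm f
  simpa only [expBasis, HilbertBasis.coe_mk] using! this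

/-- The discrete-time Fourier transform `𝓕_d[f](ω) = ∑ₜ f(t) e^{-iωt}`, as a `2π`-periodic
function of `ω ∈ ℝ`. -/
def dtft (f : EllTwo) : Freq :=
  (dtftCircle f : AddCircle (2 * π) →ₘ[AddCircle.haarAddCircle] ℂ).compQuasiMeasurePreserving
    (fun ω : ℝ => (ω : AddCircle (2 * π))) quasiMeasurePreserving_coe

lemma dtft_ae (f : EllTwo) : dtft f =ᵐ[volume] fun ω : ℝ => dtftCircle f (ω : AddCircle (2 * π)) :=
  AEEqFun.coeFn_compQuasiMeasurePreserving _ quasiMeasurePreserving_coe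

lemma dtft_eq_of_circle {f : EllTwo} {F : ℝ → ℂ} {g : Freq} (hg : g =ᵐ[volume] F)
    (G : AddCircle (2 * π) → ℂ) (hF : ∀ ω : ℝ, F ω = G ω)
    (h : dtftCircle f =ᵐ[AddCircle.haarAddCircle] G) : dtft f = g := by
  refine AEEqFun.ext ((dtft_ae f).trans ?_)
  filter_upwards [quasiMeasurePreserving_coe.ae_eq_comp h, hg] with ω h1 h2
  rw [h2, hF]; exact h1

lemma dtftCircle_single (t : ℤ) : dtftCircle (lp.single 2 t 1) = fourierLp 2 (-t) :=
  (HilbertBasis.repr_symm_single expBasis t).trans (congr_fun (HilbertBasis.coe_mk _ _) t)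

lemma dtft_delta : dtft delta = 1 := by
  have h : dtftCircle delta = fourierLp 2 0 := dtftCircle_single 0
  refine dtft_eq_of_circle (F := fun _ => 1) (AEEqFun.coeFn_one) (fun _ => 1) (fun _ => rfl) ?_
  rw [h]
  filter_upwards [coeFn_fourierLp (T := 2 * π) 2 0] with x hx
  rw [hx]; simp

lemma dtft_add (f g : EllTwo) : dtft (f + g) = dtft f + dtft g := by
  refine AEEqFun.ext ?_
  have h : dtftCircle (f + g) = dtftCircle f + dtftCircle g := map_add _ _ _
  filter_upwards [dtft_ae (f + g), dtft_ae f, dtft_ae g, AEEqFun.coeFn_add (dtft f) (dtft g),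
    quasiMeasurePreserving_coe.ae_eq_comp (Lp.coeFn_add (dtftCircle f) (dtftCircle g))]
    with ω h1 h2 h3 h4 h5
  rw [h1, h, h4, Pi.add_apply, h2, h3]; exact h5

lemma dtft_zero : dtft 0 = 0 := by
  simpa using dtft_add 0 0

/-- A map on `ℓ²` is shift invariant when it commutes with every shift operator. -/
def IsShiftInvariant (K : EllTwo → EllTwo) : Prop :=
  ∀ (τ : ℤ) (ψ : EllTwo), K (shift τ ψ) = shift τ (K ψ)

lemma shift_delta (τ : ℤ) : shift τ delta = lp.single 2 τ 1 := by
  ext t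
  simp only [shift, delta, lp.single_apply, Pi.single_apply]
  simp [sub_eq_zero]

lemma shift_add (τ : ℤ) (f g : EllTwo) : shift τ (f + g) = shift τ f + shift τ g := by
  ext t; rfl

/-- Multiplication of square-integrable functions on a period, with integrable result. -/
def mulL1 : Lp ℂ 2 (AddCircle.haarAddCircle (T := 2 * π)) →L[ℂ]
    Lp ℂ 2 (AddCircle.haarAddCircle (T := 2 * π)) →L[ℂ]
    Lp ℂ 1 (AddCircle.haarAddCircle (T := 2 * π)) :=
  (ContinuousLinearMap.mul ℂ ℂ).holderL AddCircle.haarAddCircle 2 2 1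

lemma mulL1_ae (f g : Lp ℂ 2 (AddCircle.haarAddCircle (T := 2 * π))) :
    mulL1 f g =ᵐ[AddCircle.haarAddCircle] fun x => f x * g x := by
  have := (ContinuousLinearMap.mul ℂ ℂ).coeFn_holder (r := 1) f g
  simpa [mulL1] using! this

lemma shift_single (τ s : ℤ) (c : ℂ) :
    shift τ (lp.single 2 s c) = lp.single 2 (s + τ) c := by
  ext t
  simp only [shift, lp.single_apply, Pi.single_apply]
  simp [sub_eq_iff_eq_add]

lemma shift_smul (τ : ℤ) (c : ℂ) (f : EllTwo) : shift τ (c • f) = c • shift τ f := by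
  ext t; rfl

lemma norm_shift (τ : ℤ) (f : EllTwo) : ‖shift τ f‖ = ‖f‖ := by
  rw [lp.norm_eq_tsum_rpow (by norm_num), lp.norm_eq_tsum_rpow (by norm_num)]
  congr 1
  exact (Equiv.subRight τ).tsum_eq (fun t => ‖f t‖ ^ (2 : ENNReal).toReal)

def shiftL (τ : ℤ) : EllTwo →L[ℂ] EllTwo :=
  LinearMap.mkContinuous ⟨⟨shift τ, shift_add τ⟩, fun c f => shift_smul τ c f⟩ 1
    (fun f => by simp [norm_shift])

lemma mulL1_shift (τ : ℤ) (f : EllTwo) :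
    mulL1 (fourierLp 2 0) (dtftCircle (shift τ f)) = mulL1 (fourierLp 2 (-τ)) (dtftCircle f) := by
  suffices h : (mulL1 (fourierLp 2 0)) ∘L
      (dtftCircle.toContinuousLinearEquiv : EllTwo →L[ℂ] _) ∘L (shiftL τ) =
      (mulL1 (fourierLp 2 (-τ))) ∘L (dtftCircle.toContinuousLinearEquiv : EllTwo →L[ℂ] _) from
    DFunLike.congr_fun h f
  refine lp.ext_continuousLinearMap (by norm_num) fun s => ?_
  ext1
  change mulL1 (fourierLp 2 0) (dtftCircle (shift τ (lp.single 2 s 1))) =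
    mulL1 (fourierLp 2 (-τ)) (dtftCircle (lp.single 2 s 1))
  rw [shift_single, dtftCircle_single, dtftCircle_single]
  refine Lp.ext ?_
  filter_upwards [mulL1_ae (fourierLp 2 0) (fourierLp 2 (-(s + τ))),
    mulL1_ae (fourierLp 2 (-τ)) (fourierLp 2 (-s)), coeFn_fourierLp (T := 2 * π) 2 0,
    coeFn_fourierLp (T := 2 * π) 2 (-(s + τ)), coeFn_fourierLp (T := 2 * π) 2 (-τ),
    coeFn_fourierLp (T := 2 * π) 2 (-s)] with x h1 h2 h3 h4 h5 h6
  rw [h1, h2, h3, h4, h5, h6, ← fourier_add, ← fourier_add]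
  congr 2; ring

/-- The convolution theorem for a bounded shift invariant operator. -/
lemma dtft_apply (K : EllTwo →L[ℂ] EllTwo) (hK : IsShiftInvariant K) (ψ : EllTwo) :
    dtft (K ψ) = dtft (K delta) * dtft ψ := by
  have key : mulL1 (fourierLp 2 0) (dtftCircle (K ψ)) =
      mulL1 (dtftCircle (K delta)) (dtftCircle ψ) := by
    suffices h : (mulL1 (fourierLp 2 0)) ∘L
        (dtftCircle.toContinuousLinearEquiv : EllTwo →L[ℂ] _) ∘L K =
        (mulL1 (dtftCircle (K delta))) ∘L
          (dtftCircle.toContinuousLinearEquiv : EllTwo →L[ℂ] _) from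
      DFunLike.congr_fun h ψ
    refine lp.ext_continuousLinearMap (by norm_num) fun s => ?_
    ext1
    change mulL1 (fourierLp 2 0) (dtftCircle (K (lp.single 2 s 1))) =
      mulL1 (dtftCircle (K delta)) (dtftCircle (lp.single 2 s 1))
    rw [← shift_delta, hK, mulL1_shift, shift_delta, dtftCircle_single]
    refine Lp.ext ?_
    filter_upwards [mulL1_ae (fourierLp 2 (-s)) (dtftCircle (K delta)),
      mulL1_ae (dtftCircle (K delta)) (fourierLp 2 (-s))] with x h1 h2
    rw [h1, h2, mul_comm]
  refine dtft_eq_of_circle (F := fun ω : ℝ => dtftCircle (K delta) ω * dtftCircle ψ ω) ?_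
    (fun x => dtftCircle (K delta) x * dtftCircle ψ x) (fun _ => rfl) ?_
  · filter_upwards [AEEqFun.coeFn_mul (dtft (K delta)) (dtft ψ), dtft_ae (K delta), dtft_ae ψ]
      with ω h1 h2 h3
    rw [h1, Pi.mul_apply, h2, h3]
  · filter_upwards [mulL1_ae (fourierLp 2 0) (dtftCircle (K ψ)),
      mulL1_ae (dtftCircle (K delta)) (dtftCircle ψ), coeFn_fourierLp (T := 2 * π) 2 0]
      with x h1 h2 h3
    rw [← h2, ← key, h1, h3]; simp


/-- The direct sum `⊕_A ℓ²`. -/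
abbrev SumEllTwo (A : Type u) [Fintype A] : Type u := PiLp 2 (fun _ : A => EllTwo)

/-- The injection `ι_a : ℓ² → ⊕_A ℓ²`. -/
def inj {A : Type u} [Fintype A] [DecidableEq A] (a : A) : EllTwo →L[ℂ] SumEllTwo A :=
  ((PiLp.continuousLinearEquiv 2 ℂ (fun _ : A => EllTwo)).symm :
    (A → EllTwo) →L[ℂ] SumEllTwo A) ∘L ContinuousLinearMap.single ℂ (fun _ : A => EllTwo) a

/-- The component `π_b D ι_a : ℓ² → ℓ²` of a map `D : ⊕_A ℓ² → ⊕_B ℓ²`. -/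
def component {A B : Type u} [Fintype A] [DecidableEq A] [Fintype B]
    (D : SumEllTwo A →L[ℂ] SumEllTwo B) (b : B) (a : A) : EllTwo →L[ℂ] EllTwo :=
  PiLp.proj 2 (fun _ : B => EllTwo) b ∘L D ∘L inj a

/-- Linear shift invariant maps `⊕_A ℓ² → ⊕_B ℓ²`. -/
def IsLSI {A B : Type u} [Fintype A] [DecidableEq A] [Fintype B]
    (D : SumEllTwo A →L[ℂ] SumEllTwo B) : Prop :=
  ∀ b a, IsShiftInvariant (component D b a)

/-- The frequency-domain representation `D̂ = {𝓕_d[χ_{ba}]}` of `D`, where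
`χ_{ba} = (π_b D ι_a)[δ]`. -/
def hatOf {A B : Type u} [Fintype A] [DecidableEq A] [Fintype B]
    (D : SumEllTwo A →L[ℂ] SumEllTwo B) : Matrix B A Freq :=
  Matrix.of fun b a => dtft (component D b a delta)

/-- The member at frequency `ω` of a frequency-indexed family of matrices. -/
def evalAt {A B : Type u} (M : Matrix B A Freq) (ω : ℝ) : Matrix B A ℂ :=
  M.map fun x => x ω

/-- The linear map `ℂ^A → ℂ^B` given by the matrix is a contraction for the Euclidean norms. -/
def IsContraction {A B : Type u} [Fintype A] [DecidableEq A] [Fintype B]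
    (M : Matrix B A ℂ) : Prop :=
  ∀ v : EuclideanSpace ℂ A, ‖Matrix.toEuclideanLin M v‖ ≤ ‖v‖

/-- Objects of the category `LSI_≤`: finite sets. -/
structure Obj : Type (u + 1) where
  carrier : Type u
  [fintype : Fintype carrier]
  [decidableEq : DecidableEq carrier]

attribute [instance] Obj.fintype Obj.decidableEq

instance : CoeSort Obj.{u} (Type u) := ⟨Obj.carrier⟩

/-- Morphisms `A → B` of `LSI_≤`: linear shift invariant maps `⊕_A ℓ² → ⊕_B ℓ²`, represented as
families `{f̂_ω : ℂ^A → ℂ^B}` indexed by `ω ∈ ℝ`, whose members are contractions. -/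
@[ext]
structure Hom (A B : Obj.{u}) : Type u where
  hat : Matrix B A Freq
  exists_lsi : ∃ D : SumEllTwo A →L[ℂ] SumEllTwo B, IsLSI D ∧ hatOf D = hat
  contraction : ∀ᵐ ω : ℝ, IsContraction (evalAt hat ω)

/-- Transforms of the characteristic functions of bounded shift invariant maps on `ℓ²`. -/
def IsEntry (m : Freq) : Prop :=
  ∃ K : EllTwo →L[ℂ] EllTwo, IsShiftInvariant K ∧ dtft (K delta) = m

lemma IsEntry.zero : IsEntry 0 :=
  ⟨0, fun _ _ => by ext t; rfl, by simpa using dtft_zero⟩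

lemma IsEntry.one : IsEntry 1 :=
  ⟨ContinuousLinearMap.id ℂ _, fun _ _ => rfl, dtft_delta⟩

lemma IsEntry.add {m n : Freq} (hm : IsEntry m) (hn : IsEntry n) : IsEntry (m + n) := by
  obtain ⟨K, hK, rfl⟩ := hm
  obtain ⟨L, hL, rfl⟩ := hn
  refine ⟨K + L, fun τ ψ => ?_, ?_⟩
  · simp only [add_apply, hK τ ψ, hL τ ψ, shift_add]
  · rw [← dtft_add]; rfl

lemma IsEntry.mul {m n : Freq} (hm : IsEntry m) (hn : IsEntry n) : IsEntry (m * n) := by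
  obtain ⟨K, hK, rfl⟩ := hm
  obtain ⟨L, hL, rfl⟩ := hn
  refine ⟨K ∘L L, fun τ ψ => ?_, ?_⟩
  · simp only [ContinuousLinearMap.comp_apply, hL τ ψ, hK τ (L ψ)]
  · exact dtft_apply K hK (L delta)

lemma IsEntry.sum {ι : Type u} (s : Finset ι) {m : ι → Freq} (hm : ∀ i, IsEntry (m i)) :
    IsEntry (∑ i ∈ s, m i) := by
  classical
  induction s using Finset.induction_on with
  | empty => simpa using IsEntry.zero
  | insert i s hi ih => rw [Finset.sum_insert hi]; exact (hm i).add ih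

section

variable {A B C D : Type u} [Fintype A] [DecidableEq A] [Fintype B] [DecidableEq B]
  [Fintype C] [DecidableEq C] [Fintype D] [DecidableEq D]

/-- The map `⊕_A ℓ² → ⊕_B ℓ²` with prescribed components. -/
def ofComponents (K : B → A → EllTwo →L[ℂ] EllTwo) : SumEllTwo A →L[ℂ] SumEllTwo B :=
  ((PiLp.continuousLinearEquiv 2 ℂ (fun _ : B => EllTwo)).symm :
    (B → EllTwo) →L[ℂ] SumEllTwo B) ∘L
    ContinuousLinearMap.pi fun b => ∑ a, K b a ∘L PiLp.proj 2 (fun _ : A => EllTwo) a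

lemma component_ofComponents (K : B → A → EllTwo →L[ℂ] EllTwo) (b : B) (a : A) :
    component (ofComponents K) b a = K b a := by
  ext1 ψ
  have h : ∀ a', (inj a ψ : SumEllTwo A) a' = if a' = a then ψ else 0 := by
    intro a'
    exact Pi.single_apply a ψ a'
  change (∑ a', K b a' ∘L PiLp.proj 2 (fun _ : A => EllTwo) a') (inj a ψ) = K b a ψ
  rw [sum_apply, Finset.sum_eq_single a]
  · simp [h]
  · intro a' _ ha'; simp [h, ha']
  · simp

lemma exists_lsi_iff (M : Matrix B A Freq) :
    (∃ D : SumEllTwo A →L[ℂ] SumEllTwo B, IsLSI D ∧ hatOf D = M) ↔ ∀ b a, IsEntry (M b a) := by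
  constructor
  · rintro ⟨D, hD, rfl⟩ b a
    exact ⟨component D b a, hD b a, rfl⟩
  · intro h
    choose K hK hKM using h
    refine ⟨ofComponents K, fun b a => ?_, ?_⟩
    · rw [component_ofComponents]; exact hK b a
    · ext1 b a
      rw [← hKM b a, ← component_ofComponents K b a]; rfl

lemma isContraction_one : IsContraction (1 : Matrix A A ℂ) := by
  intro v
  simp [Matrix.toLpLin_one]

lemma isContraction_zero : IsContraction (0 : Matrix B A ℂ) := by
  intro v; simp

lemma IsContraction.mul {M : Matrix C B ℂ} {N : Matrix B A ℂ} (hM : IsContraction M)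
    (hN : IsContraction N) : IsContraction (M * N) := by
  intro v
  have : Matrix.toEuclideanLin (M * N) v =
      Matrix.toEuclideanLin M (Matrix.toEuclideanLin N v) := by
    ext i; simp [Matrix.toLpLin_apply, Matrix.mulVec_mulVec]
  rw [this]
  exact (hM _).trans (hN _)

lemma isContraction_iff (M : Matrix B A ℂ) :
    IsContraction M ↔ ∀ v : A → ℂ, ∑ b, ‖(M.mulVec v) b‖ ^ 2 ≤ ∑ a, ‖v a‖ ^ 2 := by
  constructor
  · intro h v
    have := h (WithLp.toLp 2 v)
    rw [EuclideanSpace.norm_eq, EuclideanSpace.norm_eq] at this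
    exact (Real.sqrt_le_sqrt_iff (by positivity)).1 this
  · intro h v
    rw [EuclideanSpace.norm_eq, EuclideanSpace.norm_eq]
    exact Real.sqrt_le_sqrt (h v.ofLp)

lemma IsContraction.fromBlocks {M : Matrix C A ℂ} {N : Matrix D B ℂ} (hM : IsContraction M)
    (hN : IsContraction N) : IsContraction (Matrix.fromBlocks M 0 0 N) := by
  rw [isContraction_iff] at *
  intro v
  rw [Matrix.fromBlocks_mulVec, Fintype.sum_sum_type, Fintype.sum_sum_type]
  simpa using add_le_add (hM (v ∘ Sum.inl)) (hN (v ∘ Sum.inr))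

/-- The permutation matrix of a bijection. -/
def permMatrix (R : Type) [Zero R] [One R] (e : A ≃ B) : Matrix B A R :=
  Matrix.of fun b a => if e a = b then 1 else 0

lemma isContraction_perm (e : A ≃ B) : IsContraction (permMatrix ℂ e) := by
  rw [isContraction_iff]
  intro v
  have h : ∀ b, (permMatrix ℂ e).mulVec v b = v (e.symm b) := by
    intro b
    simp [permMatrix, Matrix.mulVec, dotProduct, ← Equiv.eq_symm_apply]
  simp only [h]
  exact (e.symm.sum_comp (fun a => ‖v a‖ ^ 2)).le

lemma evalAt_mul (M : Matrix C B Freq) (N : Matrix B A Freq) :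
    ∀ᵐ ω : ℝ, evalAt (M * N) ω = evalAt M ω * evalAt N ω := by
  have hs : ∀ (s : Finset B) (c : C) (a : A), ∀ᵐ ω : ℝ,
      (∑ b ∈ s, M c b * N b a : Freq) ω = ∑ b ∈ s, M c b ω * N b a ω := by
    intro s c a
    classical
    induction s using Finset.induction_on with
    | empty =>
      filter_upwards [AEEqFun.coeFn_zero (α := ℝ) (β := ℂ) (μ := volume)] with ω h
      simp [h]
    | insert b s hb ih =>
      filter_upwards [ih, AEEqFun.coeFn_add (M c b * N b a) (∑ b ∈ s, M c b * N b a),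
        AEEqFun.coeFn_mul (M c b) (N b a)] with ω h1 h2 h3
      rw [Finset.sum_insert hb, Finset.sum_insert hb, h2, Pi.add_apply, h1, h3, Pi.mul_apply]
  filter_upwards [ae_all_iff.2 fun c => ae_all_iff.2 fun a => hs Finset.univ c a] with ω h
  ext c a
  exact h c a

lemma evalAt_zero : ∀ᵐ ω : ℝ, evalAt (0 : Matrix B A Freq) ω = 0 := by
  filter_upwards [AEEqFun.coeFn_zero (α := ℝ) (β := ℂ) (μ := volume)] with ω h
  ext b a
  exact h

lemma evalAt_perm (e : A ≃ B) : ∀ᵐ ω : ℝ, evalAt (permMatrix Freq e) ω = permMatrix ℂ e := by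
  filter_upwards [AEEqFun.coeFn_zero (α := ℝ) (β := ℂ) (μ := volume),
    AEEqFun.coeFn_one (α := ℝ) (β := ℂ) (μ := volume)] with ω h0 h1
  ext b a
  by_cases h : e a = b
  · simp [evalAt, permMatrix, h, h1]
  · simp [evalAt, permMatrix, h, h0]

lemma evalAt_fromBlocks (M : Matrix C A Freq) (N : Matrix D B Freq) :
    ∀ᵐ ω : ℝ, evalAt (Matrix.fromBlocks M 0 0 N) ω =
      Matrix.fromBlocks (evalAt M ω) 0 0 (evalAt N ω) := by
  filter_upwards [AEEqFun.coeFn_zero (α := ℝ) (β := ℂ) (μ := volume)] with ω h0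
  ext i j
  rcases i with i | i <;> rcases j with j | j <;> simp [evalAt, h0]

end

/-- Composition: matrix multiplication, that is, composition at each frequency. -/
def Hom.comp {A B C : Obj.{u}} (f : Hom A B) (g : Hom B C) : Hom A C where
  hat := g.hat * f.hat
  exists_lsi := (exists_lsi_iff _).2 fun c a => IsEntry.sum _ fun b =>
    ((exists_lsi_iff _).1 g.exists_lsi c b).mul ((exists_lsi_iff _).1 f.exists_lsi b a)
  contraction := by
    filter_upwards [f.contraction, g.contraction, evalAt_mul g.hat f.hat] with ω hf hg h
    rw [h]; exact hg.mul hf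

/-- The morphism given at every frequency by the permutation matrix of a bijection. -/
def ofEquiv {A B : Obj.{u}} (e : A ≃ B) : Hom A B where
  hat := permMatrix Freq e
  exists_lsi := (exists_lsi_iff _).2 fun b a => by
    by_cases h : e a = b
    · simpa [permMatrix, h] using IsEntry.one
    · simpa [permMatrix, h] using IsEntry.zero
  contraction := by
    filter_upwards [evalAt_perm e] with ω h
    rw [h]; exact isContraction_perm e

/-- The zero morphism. -/
def zeroHom (A B : Obj.{u}) : Hom A B where
  hat := 0
  exists_lsi := (exists_lsi_iff _).2 fun _ _ => IsEntry.zero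
  contraction := by
    filter_upwards [evalAt_zero (A := A.carrier) (B := B.carrier)] with ω h
    rw [h]; exact isContraction_zero

lemma comp_hat {A B C : Obj.{u}} (f : Hom A B) (g : Hom B C) :
    (f.comp g).hat = g.hat * f.hat := rfl

lemma ofEquiv_comp_hat {A B C : Obj.{u}} (e : A ≃ B) (f : Hom B C) (c : C) (a : A) :
    ((ofEquiv e).comp f).hat c a = f.hat c (e a) := by
  simp [comp_hat, ofEquiv, permMatrix, Matrix.mul_apply]

lemma comp_ofEquiv_hat {A B C : Obj.{u}} (f : Hom A B) (e : B ≃ C) (c : C) (a : A) :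
    (f.comp (ofEquiv e)).hat c a = f.hat (e.symm c) a := by
  simp [comp_hat, ofEquiv, permMatrix, Matrix.mul_apply, ← Equiv.eq_symm_apply]

/-- Composition is matrix multiplication at each frequency, and the identity is the identity
matrix at each frequency. -/
instance instCategory : Category.{u} Obj.{u} where
  Hom := Hom
  id A := ofEquiv (Equiv.refl A)
  comp := Hom.comp
  id_comp f := Hom.ext (Matrix.ext fun c a => ofEquiv_comp_hat _ f c a)
  comp_id f := Hom.ext (Matrix.ext fun c a => comp_ofEquiv_hat f _ c a)
  assoc _ _ _ := Hom.ext (Matrix.mul_assoc _ _ _).symm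

/-- The morphism given at every frequency by the permutation matrix of a bijection. -/
def homOfEquiv {A B : Obj.{u}} (e : A ≃ B) : A ⟶ B := ofEquiv e

lemma hom_ext {A B : Obj.{u}} {f g : A ⟶ B} (h : ∀ b a, f.hat b a = g.hat b a) : f = g :=
  Hom.ext (Matrix.ext h)

lemma homOfEquiv_hat {A B : Obj.{u}} (e : A ≃ B) (b : B) (a : A) :
    (homOfEquiv e).hat b a = if e a = b then 1 else 0 := rfl

lemma homOfEquiv_refl (A : Obj.{u}) : homOfEquiv (Equiv.refl A) = 𝟙 A := rfl

lemma homOfEquiv_comp_hat {A B C : Obj.{u}} (e : A ≃ B) (f : B ⟶ C) (c : C) (a : A) :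
    (homOfEquiv e ≫ f).hat c a = f.hat c (e a) := ofEquiv_comp_hat e f c a

lemma comp_homOfEquiv_hat {A B C : Obj.{u}} (f : A ⟶ B) (e : B ≃ C) (c : C) (a : A) :
    (f ≫ homOfEquiv e).hat c a = f.hat (e.symm c) a := comp_ofEquiv_hat f e c a

lemma homOfEquiv_trans {A B C : Obj.{u}} (e : A ≃ B) (e' : B ≃ C) :
    homOfEquiv e ≫ homOfEquiv e' = homOfEquiv (e.trans e') :=
  hom_ext fun c a => by rw [homOfEquiv_comp_hat]; rfl

/-- The isomorphism given at every frequency by a permutation matrix. -/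
def isoOfEquiv {A B : Obj.{u}} (e : A ≃ B) : A ≅ B where
  hom := homOfEquiv e
  inv := homOfEquiv e.symm
  hom_inv_id := by rw [homOfEquiv_trans, Equiv.self_trans_symm]; rfl
  inv_hom_id := by rw [homOfEquiv_trans, Equiv.symm_trans_self]; rfl

/-- The disjoint union of finite sets. -/
def sumObj (A B : Obj.{u}) : Obj.{u} := ⟨A ⊕ B⟩

/-- The empty set. -/
def emptyObj : Obj.{u} := ⟨PEmpty.{u + 1}⟩

instance instIsEmptyEmptyObj : IsEmpty emptyObj.{u} := inferInstanceAs (IsEmpty PEmpty.{u + 1})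

/-- The direct sum of morphisms, computed at each frequency. -/
def sumHom {A B C D : Obj.{u}} (f : A ⟶ C) (g : B ⟶ D) : sumObj A B ⟶ sumObj C D where
  hat := Matrix.fromBlocks f.hat 0 0 g.hat
  exists_lsi := (exists_lsi_iff _).2 fun i j => by
    rcases i with i | i <;> rcases j with j | j
    · exact (exists_lsi_iff _).1 f.exists_lsi i j
    · exact IsEntry.zero
    · exact IsEntry.zero
    · exact (exists_lsi_iff _).1 g.exists_lsi i j
  contraction := by
    filter_upwards [f.contraction, g.contraction, evalAt_fromBlocks f.hat g.hat] with ω hf hg h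
    exact h ▸ hf.fromBlocks hg

/-- The disjoint union of two bijections. -/
def sumEquiv {A B C D : Obj.{u}} (e : A ≃ C) (e' : B ≃ D) : sumObj A B ≃ sumObj C D :=
  Equiv.sumCongr e e'

lemma sumHom_homOfEquiv {A B C D : Obj.{u}} (e : A ≃ C) (e' : B ≃ D) :
    sumHom (homOfEquiv e) (homOfEquiv e') = homOfEquiv (sumEquiv e e') :=
  hom_ext fun i j => by
    rw [homOfEquiv_hat]
    rcases i with i | i <;> rcases j with j | j
    · by_cases h : e j = i
      · exact (if_pos h).trans (if_pos (congrArg Sum.inl h)).symm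
      · exact (if_neg h).trans (if_neg fun h' => h (Sum.inl_injective h')).symm
    · exact (if_neg Sum.inr_ne_inl).symm
    · exact (if_neg Sum.inl_ne_inr).symm
    · by_cases h : e' j = i
      · exact (if_pos h).trans (if_pos (congrArg Sum.inr h)).symm
      · exact (if_neg h).trans (if_neg fun h' => h (Sum.inr_injective h')).symm

lemma homOfEquiv_congr {A B : Obj.{u}} {e e' : A ≃ B} (h : ∀ a, e a = e' a) :
    homOfEquiv e = homOfEquiv e' := by
  rw [Equiv.ext h]

lemma sumHom_comp {A B C A' B' C' : Obj.{u}} (f : A ⟶ B) (g : B ⟶ C) (f' : A' ⟶ B')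
    (g' : B' ⟶ C') : sumHom (f ≫ g) (f' ≫ g') = sumHom f f' ≫ sumHom g g' :=
  Hom.ext (by
    change Matrix.fromBlocks (g.hat * f.hat) 0 0 (g'.hat * f'.hat) =
      Matrix.fromBlocks g.hat 0 0 g'.hat * Matrix.fromBlocks f.hat 0 0 f'.hat
    rw [Matrix.fromBlocks_multiply]; simp)

/-- The associativity bijection. -/
def assocEquiv (A B C : Obj.{u}) : sumObj (sumObj A B) C ≃ sumObj A (sumObj B C) :=
  Equiv.sumAssoc A B C

/-- The left unit bijection. -/
def leftEquiv (A : Obj.{u}) : sumObj emptyObj A ≃ A := Equiv.emptySum emptyObj A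

/-- The right unit bijection. -/
def rightEquiv (A : Obj.{u}) : sumObj A emptyObj ≃ A := Equiv.sumEmpty A emptyObj

/-- The bijection that exchanges the two summands. -/
def commEquiv (A B : Obj.{u}) : sumObj A B ≃ sumObj B A := Equiv.sumComm A B

instance instMonoidalStruct : MonoidalCategoryStruct Obj.{u} where
  tensorObj := sumObj
  tensorUnit := emptyObj
  tensorHom := sumHom
  whiskerLeft A _ _ f := sumHom (𝟙 A) f
  whiskerRight f B := sumHom f (𝟙 B)
  associator A B C := isoOfEquiv (assocEquiv A B C)
  leftUnitor A := isoOfEquiv (leftEquiv A)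
  rightUnitor A := isoOfEquiv (rightEquiv A)

/-- The monoidal category with the disjoint union of finite sets, the direct sum of morphisms and
the empty set as unit. -/
instance instMonoidal : MonoidalCategory Obj.{u} := MonoidalCategory.ofTensorHom
  (id_tensorHom_id := fun A B => by
    refine (sumHom_homOfEquiv (Equiv.refl A) (Equiv.refl B)).trans (homOfEquiv_congr ?_)
    rintro (a | a) <;> rfl)
  (id_tensorHom := fun _ _ _ _ => rfl)
  (tensorHom_id := fun _ _ => rfl)
  (tensorHom_comp_tensorHom := fun f₁ f₂ g₁ g₂ => (sumHom_comp f₁ g₁ f₂ g₂).symm)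
  (associator_naturality := fun {A B C A' B' C'} f g h => hom_ext fun i j => by
    refine (comp_homOfEquiv_hat _ (assocEquiv A' B' C') i j).trans
      (Eq.trans ?_ (homOfEquiv_comp_hat (assocEquiv A B C) _ i j).symm)
    rcases i with i | i | i <;> rcases j with (j | j) | j <;> rfl)
  (leftUnitor_naturality := fun {A B} f => hom_ext fun i j => by
    refine (comp_homOfEquiv_hat _ (leftEquiv B) i j).trans
      (Eq.trans ?_ (homOfEquiv_comp_hat (leftEquiv A) _ i j).symm)
    rcases j with j | j
    · exact PEmpty.elim j
    · rfl)
  (rightUnitor_naturality := fun {A B} f => hom_ext fun i j => by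
    refine (comp_homOfEquiv_hat _ (rightEquiv B) i j).trans
      (Eq.trans ?_ (homOfEquiv_comp_hat (rightEquiv A) _ i j).symm)
    rcases j with j | j
    · rfl
    · exact PEmpty.elim j)
  (pentagon := fun A B C D => by
    change sumHom (homOfEquiv (assocEquiv A B C)) (homOfEquiv (Equiv.refl D)) ≫
      homOfEquiv (assocEquiv A (sumObj B C) D) ≫
        sumHom (homOfEquiv (Equiv.refl A)) (homOfEquiv (assocEquiv B C D)) =
      homOfEquiv (assocEquiv (sumObj A B) C D) ≫ homOfEquiv (assocEquiv A B (sumObj C D))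
    simp only [sumHom_homOfEquiv, homOfEquiv_trans]
    refine homOfEquiv_congr ?_
    rintro (((a | a) | a) | a) <;> rfl)
  (triangle := fun A B => by
    change homOfEquiv (assocEquiv A emptyObj B) ≫
        sumHom (homOfEquiv (Equiv.refl A)) (homOfEquiv (leftEquiv B)) =
      sumHom (homOfEquiv (rightEquiv A)) (homOfEquiv (Equiv.refl B))
    simp only [sumHom_homOfEquiv, homOfEquiv_trans]
    refine homOfEquiv_congr ?_
    rintro ((a | a) | a)
    · rfl
    · exact PEmpty.elim a
    · rfl)

/-- The braiding exchanges the two summands. -/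
instance instBraided : BraidedCategory Obj.{u} where
  braiding A B := isoOfEquiv (commEquiv A B)
  braiding_naturality_right X {Y Z} f := hom_ext fun i j => by
    refine (comp_homOfEquiv_hat _ (commEquiv X Z) i j).trans
      (Eq.trans ?_ (homOfEquiv_comp_hat (commEquiv X Y) _ i j).symm)
    rcases i with i | i <;> rcases j with j | j <;> rfl
  braiding_naturality_left {X Y} f Z := hom_ext fun i j => by
    refine (comp_homOfEquiv_hat _ (commEquiv Y Z) i j).trans
      (Eq.trans ?_ (homOfEquiv_comp_hat (commEquiv X Z) _ i j).symm)
    rcases i with i | i <;> rcases j with j | j <;> rfl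
  hexagon_forward X Y Z := by
    change homOfEquiv (assocEquiv X Y Z) ≫ homOfEquiv (commEquiv X (sumObj Y Z)) ≫
        homOfEquiv (assocEquiv Y Z X) =
      sumHom (homOfEquiv (commEquiv X Y)) (homOfEquiv (Equiv.refl Z)) ≫
        homOfEquiv (assocEquiv Y X Z) ≫
        sumHom (homOfEquiv (Equiv.refl Y)) (homOfEquiv (commEquiv X Z))
    simp only [sumHom_homOfEquiv, homOfEquiv_trans]
    refine homOfEquiv_congr ?_
    rintro ((a | a) | a) <;> rfl
  hexagon_reverse X Y Z := by
    change homOfEquiv (assocEquiv X Y Z).symm ≫ homOfEquiv (commEquiv (sumObj X Y) Z) ≫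
        homOfEquiv (assocEquiv Z X Y).symm =
      sumHom (homOfEquiv (Equiv.refl X)) (homOfEquiv (commEquiv Y Z)) ≫
        homOfEquiv (assocEquiv X Z Y).symm ≫
        sumHom (homOfEquiv (commEquiv X Z)) (homOfEquiv (Equiv.refl Y))
    simp only [sumHom_homOfEquiv, homOfEquiv_trans]
    refine homOfEquiv_congr ?_
    rintro (a | a | a) <;> rfl

instance instSymmetric : SymmetricCategory Obj.{u} where
  symmetry A B := by
    change homOfEquiv (commEquiv A B) ≫ homOfEquiv (commEquiv B A) =
      homOfEquiv (Equiv.refl (sumObj A B))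
    rw [homOfEquiv_trans]
    refine homOfEquiv_congr ?_
    rintro (a | a) <;> rfl

section Execution

variable {A B U : Obj.{u}}

/-- The zero morphism. -/
def zero (A B : Obj.{u}) : A ⟶ B := zeroHom A B

/-- The quasi-projection `π_A : A ⊕ U → A`. -/
def fst (A U : Obj.{u}) : A ⊗ U ⟶ A := (𝟙 A ⊗ₘ zero U (𝟙_ Obj)) ≫ (ρ_ A).hom

/-- The quasi-injection `ι_A : A → A ⊕ U`. -/
def inl (A U : Obj.{u}) : A ⟶ A ⊗ U := (ρ_ A).inv ≫ (𝟙 A ⊗ₘ zero (𝟙_ Obj) U)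

/-- The quasi-projection `π_U : A ⊕ U → U`. -/
def snd (A U : Obj.{u}) : A ⊗ U ⟶ U := (zero A (𝟙_ Obj) ⊗ₘ 𝟙 U) ≫ (λ_ U).hom

/-- The quasi-injection `ι_U : U → A ⊕ U`. -/
def inr (A U : Obj.{u}) : U ⟶ A ⊗ U := (λ_ U).inv ≫ (zero (𝟙_ Obj) A ⊗ₘ 𝟙 U)

/-- The component `f_BA` of `f : A ⊕ U → B ⊕ U`. -/
def compBA (f : A ⊗ U ⟶ B ⊗ U) : A ⟶ B := inl A U ≫ f ≫ fst B U

/-- The component `f_BU` of `f : A ⊕ U → B ⊕ U`. -/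
def compBU (f : A ⊗ U ⟶ B ⊗ U) : U ⟶ B := inr A U ≫ f ≫ fst B U

/-- The component `f_UA` of `f : A ⊕ U → B ⊕ U`. -/
def compUA (f : A ⊗ U ⟶ B ⊗ U) : A ⟶ U := inl A U ≫ f ≫ snd B U

/-- The component `f_UU` of `f : A ⊕ U → B ⊕ U`. -/
def compUU (f : A ⊗ U ⟶ B ⊗ U) : U ⟶ U := inr A U ≫ f ≫ snd B U

/-- Iterated composition of an endomorphism. -/
def iter (h : U ⟶ U) : ℕ → (U ⟶ U)
  | 0 => 𝟙 U
  | n + 1 => iter h n ≫ h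

/-- The family `{f_BA} ⊎ {f_BU f_UU^n f_UA}_{n ∈ ℕ}`. -/
def paths (f : A ⊗ U ⟶ B ⊗ U) : Unit ⊕ ℕ → (A ⟶ B) :=
  Sum.elim (fun _ => compBA f) fun n => compUA f ≫ iter (compUU f) n ≫ compBU f

/-- `Σ f = g` in `LSI_≤`: at each frequency, the net of finite partial sums of the countable
family `{(f̂_i)_ω}` converges to `ĝ_ω`. -/
def IsSum {ι : Type v} [Countable ι] (f : ι → (A ⟶ B)) (g : A ⟶ B) : Prop :=
  ∀ᵐ ω : ℝ, HasSum (fun i => evalAt (f i).hat ω) (evalAt g.hat ω)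

end Execution

/-- The axioms of a (total) trace on a symmetric monoidal category. -/
structure IsTrace {C : Type u} [Category.{v} C] [MonoidalCategory C] [SymmetricCategory C]
    (tr : ∀ A B U : C, (A ⊗ U ⟶ B ⊗ U) → (A ⟶ B)) : Prop where
  naturality : ∀ {A A' B B' U : C} (g : A' ⟶ A) (f : A ⊗ U ⟶ B ⊗ U) (h : B ⟶ B'),
    g ≫ tr A B U f ≫ h = tr A' B' U ((g ▷ U) ≫ f ≫ (h ▷ U))
  dinaturality : ∀ {A B U U' : C} (f : A ⊗ U ⟶ B ⊗ U') (g : U' ⟶ U),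
    tr A B U (f ≫ (B ◁ g)) = tr A B U' ((A ◁ g) ≫ f)
  superposing : ∀ {A B D E U : C} (g : D ⟶ E) (f : A ⊗ U ⟶ B ⊗ U),
    g ⊗ₘ tr A B U f = tr (D ⊗ A) (E ⊗ B) U ((α_ D A U).hom ≫ (g ⊗ₘ f) ≫ (α_ E B U).inv)
  vanishing_unit : ∀ {A B : C} (f : A ⊗ 𝟙_ C ⟶ B ⊗ 𝟙_ C),
    tr A B (𝟙_ C) f = (ρ_ A).inv ≫ f ≫ (ρ_ B).hom
  vanishing_tensor : ∀ {A B U V : C} (f : (A ⊗ U) ⊗ V ⟶ (B ⊗ U) ⊗ V),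
    tr A B U (tr (A ⊗ U) (B ⊗ U) V f) =
      tr A B (U ⊗ V) ((α_ A U V).inv ≫ f ≫ (α_ B U V).hom)
  yanking : ∀ U : C, tr U U U (β_ U U).hom = 𝟙 U

end LSI

end

/-!
A contraction dissipates energy: if `f = [a b; c d]` is a contraction, then
`‖b dⁿ u‖² + ‖dⁿ⁺¹ u‖² ≤ ‖dⁿ u‖²`, hence `b dⁿ → 0`, and the same argument for the adjoint gives
`dⁿ c → 0`. On the finite-dimensional space of vectors `v` with `dⁿ v → 0` some power of `d` has
norm less than `1`, so `S = Σ dⁿ c` converges geometrically. It solves `S = c + d S`, that is,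
`f (x, S x) = ((a + b S) x, S x)`, and since `f` is a contraction so is `a + b S`. This holds at
almost every frequency; since bounded periodic functions are transforms of shift invariant maps,
`ex f = a + b S` is a morphism even when `S` is not bounded in the frequency.

Solutions `u` of `f (x, u) = (y, u)` need not be unique, but the output `y` is: by linearity it
suffices to take `x = 0`, and then `‖y‖² + ‖u‖² ≤ ‖u‖²`. Hence `ex f` is the only morphism whose
values are outputs of feedback solutions of `f`, and each trace identity amounts to turning feedback
solutions of one side into feedback solutions of the other.
-/

noncomputable section

namespace LSI

open Filter Matrix
open scoped Topology

/-! ### Block contractions -/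

lemma summable_norm_pow_of_tendsto_zero {R : Type*} [NormedRing R] {x : R}
    (hx : Tendsto (fun n : ℕ => x ^ n) atTop (𝓝 0)) : Summable fun n : ℕ => ‖x ^ n‖ := by
  obtain ⟨N, hN, hlt⟩ : ∃ N ≥ 1, ‖x ^ N‖ < 1 :=
    ((eventually_ge_atTop 1).and (hx.norm.eventually_lt_const (by simp))).exists
  have : NeZero N := ⟨by omega⟩
  have hle (q r : ℕ) : ‖x ^ (q * N + r)‖ ≤ ‖x ^ N‖ ^ q * ‖x ^ r‖ := by
    induction q with
    | zero => simp
    | succ q ih =>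
      calc ‖x ^ ((q + 1) * N + r)‖ = ‖x ^ N * x ^ (q * N + r)‖ := by
            rw [← pow_add]; congr 2; ring
        _ ≤ ‖x ^ N‖ * (‖x ^ N‖ ^ q * ‖x ^ r‖) := (norm_mul_le _ _).trans (by gcongr)
        _ = ‖x ^ N‖ ^ (q + 1) * ‖x ^ r‖ := by ring
  have hgeom : Summable fun i : ℕ × Fin N => ‖x ^ N‖ ^ i.1 * ‖x ^ (i.2 : ℕ)‖ :=
    (summable_geometric_of_lt_one (norm_nonneg _) hlt).mul_of_nonneg
      (g := fun r : Fin N => ‖x ^ (r : ℕ)‖) (.of_finite) (fun _ => by positivity)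
      (fun _ => norm_nonneg _)
  rw [← (Nat.divModEquiv N).symm.summable_iff]
  exact hgeom.of_nonneg_of_le (fun _ => norm_nonneg _) fun i => hle i.1 i.2

lemma tendsto_zero_of_norm_sq_add_norm_sq_le {E F : Type*} [SeminormedAddGroup E]
    [SeminormedAddGroup F] {u : ℕ → E} {y : ℕ → F}
    (h : ∀ n, ‖y n‖ ^ 2 + ‖u (n + 1)‖ ^ 2 ≤ ‖u n‖ ^ 2) : Tendsto y atTop (𝓝 0) := by
  have hanti : Antitone fun n => ‖u n‖ ^ 2 := antitone_nat_of_succ_le fun n => by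
    linarith [h n, sq_nonneg ‖y n‖]
  have hlim := tendsto_atTop_ciInf hanti ⟨0, by rintro _ ⟨n, rfl⟩; positivity⟩
  have hdiff := hlim.sub (hlim.comp (tendsto_add_atTop_nat 1))
  rw [sub_self] at hdiff
  have hsq : Tendsto (fun n => ‖y n‖ ^ 2) atTop (𝓝 0) :=
    squeeze_zero (fun n => by positivity) (fun n => le_sub_iff_add_le.2 (h n)) hdiff
  rw [tendsto_zero_iff_norm_tendsto_zero]
  simpa using hsq.sqrt

lemma tendsto_zero_of_forall_tendsto_apply {𝕜 E F : Type*} [NontriviallyNormedField 𝕜]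
    [CompleteSpace 𝕜] [NormedAddCommGroup E] [NormedSpace 𝕜 E] [FiniteDimensional 𝕜 E]
    [NormedAddCommGroup F] [NormedSpace 𝕜 F] {ι : Type*} {l : Filter ι} {T : ι → E →L[𝕜] F}
    (hT : ∀ v, Tendsto (fun i => T i v) l (𝓝 0)) : Tendsto T l (𝓝 0) := by
  obtain ⟨C, -, hC⟩ := (Module.finBasis 𝕜 E).exists_opNorm_le (F := F)
  have hlim := (tendsto_finsetSum Finset.univ fun j _ =>
    (hT (Module.finBasis 𝕜 E j)).norm).const_mul C
  simp only [norm_zero, Finset.sum_const_zero, mul_zero] at hlim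
  refine squeeze_zero_norm (fun i => hC (by positivity) fun j => ?_) hlim
  exact Finset.single_le_sum (f := fun j => ‖T i (Module.finBasis 𝕜 E j)‖)
    (fun _ _ => norm_nonneg _) (Finset.mem_univ j)

lemma summable_pow_apply_of_tendsto_zero {𝕜 E : Type*} [NontriviallyNormedField 𝕜]
    [CompleteSpace 𝕜] [NormedAddCommGroup E] [NormedSpace 𝕜 E] [FiniteDimensional 𝕜 E]
    {d : E →L[𝕜] E} {v : E} (hv : Tendsto (fun n : ℕ => (d ^ n) v) atTop (𝓝 0)) :
    Summable fun n : ℕ => (d ^ n) v := by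
  let W : Submodule 𝕜 E :=
    { carrier := {w | Tendsto (fun n : ℕ => (d ^ n) w) atTop (𝓝 0)}
      add_mem' := fun hw hw' => by simpa using hw.add hw'
      zero_mem' := by simp
      smul_mem' := fun r w hw => by
        simpa only [Set.mem_ofPred_eq, map_smul, smul_zero] using hw.const_smul r }
  have hdW : ∀ w ∈ W, d w ∈ W := fun w hw => hw.comp (tendsto_add_atTop_nat 1)
  let dW : W →L[𝕜] W := (d.comp W.subtypeL).codRestrict W fun w => hdW w w.2
  have hpow (n : ℕ) (w : W) : ((dW ^ n) w : E) = (d ^ n) w := by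
    induction n generalizing w with
    | zero => rfl
    | succ _ ih => exact ih (dW w)
  have hdW0 : Tendsto (fun n : ℕ => dW ^ n) atTop (𝓝 0) := by
    refine tendsto_zero_of_forall_tendsto_apply fun w => ?_
    rw [tendsto_subtype_rng]
    exact Tendsto.congr (fun n => (hpow n w).symm) w.2
  have : CompleteSpace W := FiniteDimensional.complete 𝕜 W
  simpa only [ContinuousLinearMap.comp_apply, ContinuousLinearMap.apply_apply,
    Submodule.subtypeL_apply, hpow] using (summable_norm_pow_of_tendsto_zero hdW0).of_norm.mapL
     (W.subtypeL.comp (ContinuousLinearMap.apply 𝕜 W ⟨v, hv⟩))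

lemma add_mul_eq_of_hasSum_pow_mul {A U R : Type*} [Fintype U] [DecidableEq U] [Ring R]
    [TopologicalSpace R] [IsTopologicalRing R] [T2Space R] {c S : Matrix U A R}
    {d : Matrix U U R} (hS : HasSum (fun n : ℕ => d ^ n * c) S) : c + d * S = S := by
  have hshift : HasSum (fun n : ℕ => d ^ (n + 1) * c) (d * S) := by
    simp only [pow_succ', Matrix.mul_assoc]
    exact hS.map (addMonoidHomMulLeft d) (continuous_const.matrix_mul continuous_id)
  have hsplit : HasSum (fun n : ℕ => d ^ n * c) (d ^ 0 * c + d * S) := HasSum.zero_add hshift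
  rw [pow_zero, Matrix.one_mul] at hsplit
  exact hsplit.unique hS

section Contraction

variable {A B U : Type u} [Fintype A] [DecidableEq A] [Fintype B] [Fintype U] [DecidableEq U]

open scoped Matrix.Norms.L2Operator in
lemma isContraction_iff_norm_le_one {M : Matrix B A ℂ} : IsContraction M ↔ ‖M‖ ≤ 1 := by
  rw [l2_opNorm_def, ContinuousLinearMap.opNorm_le_iff zero_le_one]
  simp only [one_mul]
  rfl

lemma IsContraction.conjTranspose [DecidableEq B] {M : Matrix B A ℂ} (h : IsContraction M) :
    IsContraction Mᴴ := by
  rw [isContraction_iff_norm_le_one] at h ⊢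
  exact (l2_opNorm_conjTranspose M).trans_le h

lemma IsContraction.norm_apply_le_one {M : Matrix B A ℂ} (h : IsContraction M) (b : B) (a : A) :
    ‖M b a‖ ≤ 1 := by
  have hcol := (PiLp.norm_apply_le _ b).trans (h (EuclideanSpace.single a 1))
  simpa [toLpLin_apply] using hcol

section Loop

variable {a : Matrix B A ℂ} {b : Matrix B U ℂ} {c : Matrix U A ℂ} {d : Matrix U U ℂ}

lemma IsContraction.sum_norm_sq_fromBlocks_le (h : IsContraction (Matrix.fromBlocks a b c d))
    (x : A → ℂ) (u : U → ℂ) :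
    ∑ i, ‖(a *ᵥ x + b *ᵥ u) i‖ ^ 2 + ∑ j, ‖(c *ᵥ x + d *ᵥ u) j‖ ^ 2 ≤
      ∑ i, ‖x i‖ ^ 2 + ∑ j, ‖u j‖ ^ 2 := by
  classical
  simpa [fromBlocks_mulVec] using (isContraction_iff _).1 h (Sum.elim x u)

lemma IsContraction.tendsto_mul_pow (h : IsContraction (Matrix.fromBlocks a b c d)) :
    Tendsto (fun n : ℕ => b * d ^ n) atTop (𝓝 0) := by
  have hcol (j : U) : Tendsto (fun n => WithLp.toLp 2 ((b * d ^ n).col j)) atTop (𝓝 0) := by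
    refine tendsto_zero_of_norm_sq_add_norm_sq_le
      (u := fun n => WithLp.toLp 2 ((d ^ n).col j)) fun n => ?_
    simp only [EuclideanSpace.norm_sq_eq, pow_succ' d, ← mulVec_single_one, ← mulVec_mulVec]
    simpa only [mulVec_zero, zero_add, Pi.zero_apply, norm_zero, ne_eq, OfNat.ofNat_ne_zero,
      not_false_eq_true, zero_pow, Finset.sum_const_zero] using
      h.sum_norm_sq_fromBlocks_le 0 (d ^ n *ᵥ Pi.single j 1)
  refine tendsto_pi_nhds.2 fun i => tendsto_pi_nhds.2 fun j => ?_
  exact ((EuclideanSpace.proj (𝕜 := ℂ) i).continuous.tendsto 0).comp (hcol j)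

lemma IsContraction.tendsto_pow_mul (h : IsContraction (Matrix.fromBlocks a b c d)) :
    Tendsto (fun n : ℕ => d ^ n * c) atTop (𝓝 0) := by
  classical
  have hadj := h.conjTranspose
  rw [fromBlocks_conjTranspose] at hadj
  have := (continuous_id.matrix_conjTranspose.tendsto 0).comp hadj.tendsto_mul_pow
  simpa [Function.comp_def, conjTranspose_pow] using this

lemma IsContraction.summable_pow_mul (h : IsContraction (Matrix.fromBlocks a b c d)) :
    Summable fun n : ℕ => d ^ n * c := by
  have hpow (n : ℕ) (j : A) : (toEuclideanCLM (𝕜 := ℂ) d ^ n) (WithLp.toLp 2 (c.col j)) =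
      WithLp.toLp 2 ((d ^ n * c).col j) := by
    rw [← map_pow, toEuclideanCLM_toLp]; rfl
  have hcol (j : A) :
      Summable fun n : ℕ => (toEuclideanCLM (𝕜 := ℂ) d ^ n) (WithLp.toLp 2 (c.col j)) := by
    refine summable_pow_apply_of_tendsto_zero ?_
    simp only [hpow]
    have hlim : Tendsto (fun n : ℕ => (d ^ n * c).col j) atTop (𝓝 0) :=
      tendsto_pi_nhds.2 fun i => (h.tendsto_pow_mul.apply_nhds i).apply_nhds j
    exact ((PiLp.continuous_toLp 2 _).tendsto 0).comp hlim
  refine Pi.summable.2 fun i => Pi.summable.2 fun j => ?_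
  simp only [hpow] at hcol
  exact (hcol j).mapL (EuclideanSpace.proj (𝕜 := ℂ) i)

end Loop

lemma IsContraction.feedback {a : Matrix B A ℂ} {b : Matrix B U ℂ} {c S : Matrix U A ℂ}
    {d : Matrix U U ℂ} (h : IsContraction (Matrix.fromBlocks a b c d))
    (hS : c + d * S = S) : IsContraction (a + b * S) := by
  classical
  refine (isContraction_iff _).2 fun x => ?_
  have hx := h.sum_norm_sq_fromBlocks_le x (S *ᵥ x)
  rw [mulVec_mulVec, mulVec_mulVec, ← add_mulVec, ← add_mulVec, hS] at hx
  exact le_of_add_le_add_right hx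

end Contraction

/-! ### Bounded periodic transforms -/

lemma dtftCircle_shift_ae (τ : ℤ) (ψ : EllTwo) :
    dtftCircle (shift τ ψ) =ᵐ[AddCircle.haarAddCircle]
      fun x => fourier (-τ) x * dtftCircle ψ x := by
  filter_upwards [mulL1_ae (fourierLp 2 0) (dtftCircle (shift τ ψ)),
    mulL1_ae (fourierLp 2 (-τ)) (dtftCircle ψ), coeFn_fourierLp (T := 2 * π) 2 0,
    coeFn_fourierLp (T := 2 * π) 2 (-τ)] with x hshift hmul hone hfourier
  rw [mulL1_shift, hmul, hone, hfourier] at hshift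
  simpa using hshift.symm

lemma exists_isShiftInvariant_dtftCircle_ae_eq_mul {G : AddCircle (2 * π) → ℂ}
    (hG : MemLp G ⊤ AddCircle.haarAddCircle) : ∃ K : EllTwo →L[ℂ] EllTwo, IsShiftInvariant K ∧
      ∀ ψ, dtftCircle (K ψ) =ᵐ[AddCircle.haarAddCircle] fun x => G x * dtftCircle ψ x := by
  let T := (ContinuousLinearMap.mul ℂ ℂ).holderL AddCircle.haarAddCircle ⊤ 2 2 (hG.toLp G)
  let K : EllTwo →L[ℂ] EllTwo :=
    (dtftCircle.symm.toContinuousLinearEquiv : _ →L[ℂ] EllTwo) ∘L T ∘L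
      (dtftCircle.toContinuousLinearEquiv : EllTwo →L[ℂ] _)
  have hK (ψ : EllTwo) : dtftCircle (K ψ) =ᵐ[AddCircle.haarAddCircle]
      fun x => G x * dtftCircle ψ x := by
    rw [show dtftCircle (K ψ) = T (dtftCircle ψ) from dtftCircle.apply_symm_apply _]
    filter_upwards [(ContinuousLinearMap.mul ℂ ℂ).coeFn_holder (r := 2) (hG.toLp G)
      (dtftCircle ψ), hG.coeFn_toLp] with x hmul hGx
    rw [← hGx]
    exact hmul
  refine ⟨K, fun τ ψ => dtftCircle.injective (Lp.ext ?_), hK⟩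
  filter_upwards [hK (shift τ ψ), dtftCircle_shift_ae τ ψ, dtftCircle_shift_ae τ (K ψ), hK ψ]
    with x h₁ h₂ h₃ h₄
  rw [h₁, h₂, h₃, h₄, mul_left_comm]

lemma IsEntry.of_memLp_top {m : Freq} {G : AddCircle (2 * π) → ℂ}
    (hG : MemLp G ⊤ AddCircle.haarAddCircle) (hm : m =ᵐ[volume] fun ω : ℝ => G ω) :
    IsEntry m := by
  obtain ⟨K, hK, hKG⟩ := exists_isShiftInvariant_dtftCircle_ae_eq_mul hG
  refine ⟨K, hK, dtft_eq_of_circle hm G (fun _ => rfl) ?_⟩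
  have hdelta : dtftCircle delta = fourierLp 2 0 := dtftCircle_single 0
  filter_upwards [hKG delta, coeFn_fourierLp (T := 2 * π) 2 0] with x hx hone
  rw [hx, hdelta, hone, fourier_zero, mul_one]

lemma IsEntry.of_tendsto {ι : Type*} [Countable ι] {l : Filter ι} [l.NeBot]
    [l.IsCountablyGenerated] {m : ι → Freq} {g : Freq} {C : ℝ} (hm : ∀ i, IsEntry (m i))
    (hg : ∀ᵐ ω : ℝ, Tendsto (fun i => m i ω) l (𝓝 (g ω))) (hC : ∀ᵐ ω : ℝ, ‖g ω‖ ≤ C) :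
    IsEntry g := by
  choose K _ hKm using hm
  let G (x : AddCircle (2 * π)) : ℂ := limUnder l fun i => dtftCircle (K i delta) x
  have hG : StronglyMeasurable G := .limUnder fun i => Lp.stronglyMeasurable _
  let s : Set (AddCircle (2 * π)) := {x | ‖G x‖ ≤ C}
  have hs : MeasurableSet s := measurableSet_le hG.norm.measurable measurable_const
  have hbound (x : AddCircle (2 * π)) : ‖s.indicator G x‖ ≤ max C 0 := by
    by_cases hx : x ∈ s
    · rw [Set.indicator_of_mem hx]
      exact le_max_of_le_left hx
    · rw [Set.indicator_of_notMem hx, norm_zero]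
      exact le_max_right C 0
  refine .of_memLp_top (memLp_top_of_bound (hG.indicator hs).aestronglyMeasurable (max C 0)
    (.of_forall hbound)) ?_
  filter_upwards [hg, hC, ae_all_iff.2 fun i => dtft_ae (K i delta)] with ω hlim hω hK
  have hGω : G ω = g ω := by
    refine Tendsto.limUnder_eq (hlim.congr fun i => ?_)
    rw [← hK, hKm]
  have hmem : (ω : AddCircle (2 * π)) ∈ s := by rwa [← hGω] at hω
  rw [Set.indicator_of_mem hmem, hGω]

/-! ### Matrices of functions of the frequency -/

lemma exists_ae_hasSum_of_ae_summable {α E ι : Type*} [MeasurableSpace α] {μ : Measure α}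
    [TopologicalSpace E] [TopologicalSpace.PseudoMetrizableSpace E] [AddCommMonoid E]
    [ContinuousAdd E] [Countable ι] {m : ι → α →ₘ[μ] E} (h : ∀ᵐ x ∂μ, Summable fun i => m i x) :
    ∃ s : α →ₘ[μ] E, ∀ᵐ x ∂μ, HasSum (fun i => m i x) (s x) := by
  have hmeas : AEStronglyMeasurable (fun x => ∑' i, m i x) μ :=
    aestronglyMeasurable_of_tendsto_ae atTop
      (fun F : Finset ι => F.aestronglyMeasurable_fun_sum fun i _ => (m i).aestronglyMeasurable)
      (h.mono fun x hx => hx.hasSum)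
  refine ⟨AEEqFun.mk _ hmeas, ?_⟩
  filter_upwards [h, AEEqFun.coeFn_mk _ hmeas] with x hx hmk
  rw [hmk]
  exact hx.hasSum

lemma IsEntry.of_hasSum {ι : Type u} [Countable ι] {m : ι → Freq} {g : Freq} {C : ℝ}
    (hm : ∀ i, IsEntry (m i)) (hg : ∀ᵐ ω : ℝ, HasSum (fun i => m i ω) (g ω))
    (hC : ∀ᵐ ω : ℝ, ‖g ω‖ ≤ C) : IsEntry g := by
  refine .of_tendsto (m := fun s : Finset ι => ∑ i ∈ s, m i) (l := atTop)
    (fun s => .sum s hm) ?_ hC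
  filter_upwards [hg, ae_all_iff.2 fun s : Finset ι => AEEqFun.coeFn_fun_finsetSum s m]
    with ω hω hsum
  exact Tendsto.congr (fun s => (hsum s).symm) hω

section EvalAt

variable {A B U : Type u}

lemma eq_of_ae_evalAt_eq {M N : Matrix B A Freq} (h : ∀ᵐ ω : ℝ, evalAt M ω = evalAt N ω) :
    M = N :=
  Matrix.ext fun b a => AEEqFun.ext <| h.mono fun _ hω => congrFun (congrFun hω b) a

lemma evalAt_add [Finite A] [Finite B] (M N : Matrix B A Freq) :
    ∀ᵐ ω : ℝ, evalAt (M + N) ω = evalAt M ω + evalAt N ω := by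
  filter_upwards [ae_all_iff.2 fun b => ae_all_iff.2 fun a => AEEqFun.coeFn_add (M b a) (N b a)]
    with ω h
  ext b a
  exact h b a

lemma evalAt_one [DecidableEq A] : ∀ᵐ ω : ℝ, evalAt (1 : Matrix A A Freq) ω = 1 := by
  filter_upwards [AEEqFun.coeFn_zero (α := ℝ) (β := ℂ) (μ := volume),
    AEEqFun.coeFn_one (α := ℝ) (β := ℂ) (μ := volume)] with ω hzero hone
  exact Matrix.map_one (fun m : Freq => m ω) hzero hone

lemma evalAt_pow [Fintype A] [DecidableEq A] (M : Matrix A A Freq) :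
    ∀ᵐ ω : ℝ, ∀ n : ℕ, evalAt (M ^ n) ω = evalAt M ω ^ n := by
  filter_upwards [evalAt_one (A := A), ae_all_iff.2 fun n : ℕ => evalAt_mul (M ^ n) M]
    with ω hone hmul n
  induction n with
  | zero => simpa only [pow_zero] using hone
  | succ n ih => rw [pow_succ, hmul, ih, pow_succ]

lemma evalAt_mulVec [Fintype A] [Finite B] (M : Matrix B A Freq) (x : A → Freq) :
    ∀ᵐ ω : ℝ, ∀ b, (M *ᵥ x) b ω = (evalAt M ω *ᵥ fun a => x a ω) b := by
  classical
  have := Fintype.ofFinite B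
  filter_upwards [evalAt_mul M (replicateCol PUnit x)] with ω h b
  exact congrFun (congrFun h b) PUnit.unit

lemma sum_norm_sq_mulVec_le [Fintype A] [DecidableEq A] [Fintype B] {M : Matrix B A Freq}
    (hM : ∀ᵐ ω : ℝ, IsContraction (evalAt M ω)) (x : A → Freq) :
    ∀ᵐ ω : ℝ, ∑ b, ‖(M *ᵥ x) b ω‖ ^ 2 ≤ ∑ a, ‖x a ω‖ ^ 2 := by
  classical
  filter_upwards [hM, evalAt_mulVec M x] with ω hω heval
  simp only [heval]
  exact (isContraction_iff _).1 hω _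

lemma exists_hasSum_evalAt [Finite A] [Finite U] {M : ℕ → Matrix U A Freq}
    (h : ∀ᵐ ω : ℝ, Summable fun n => evalAt (M n) ω) :
    ∃ S : Matrix U A Freq, ∀ᵐ ω : ℝ, HasSum (fun n => evalAt (M n) ω) (evalAt S ω) := by
  have hentry (u : U) (a : A) : ∃ s : Freq, ∀ᵐ ω : ℝ, HasSum (fun n => M n u a ω) (s ω) :=
    exists_ae_hasSum_of_ae_summable (h.mono fun ω hω => Pi.summable.1 (Pi.summable.1 hω u) a)
  choose S hS using hentry
  refine ⟨S, ?_⟩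
  filter_upwards [ae_all_iff.2 fun u => ae_all_iff.2 fun a => hS u a] with ω hω
  exact Pi.hasSum.2 fun u => Pi.hasSum.2 fun a => hω u a

end EvalAt

/-! ### Plancherel -/

lemma lintegral_dtft (ψ : EllTwo) :
    ∫⁻ ω in Set.Ioc 0 (2 * π), ‖dtft ψ ω‖ₑ ^ 2 = ENNReal.ofReal (2 * π) * ‖ψ‖ₑ ^ 2 := by
  have hnorm : ‖ψ‖ₑ ^ 2 = ∫⁻ x, ‖dtftCircle ψ x‖ₑ ^ 2 ∂AddCircle.haarAddCircle := by
    rw [← dtftCircle.enorm_map ψ, Lp.enorm_def]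
    simpa only [NNReal.coe_ofNat, ENNReal.rpow_ofNat, ENNReal.coe_ofNat] using
      eLpNorm_nnreal_pow_eq_lintegral (f := dtftCircle ψ) (p := 2)
        (μ := AddCircle.haarAddCircle) two_ne_zero
  have hcircle : ∫⁻ ω in Set.Ioc 0 (0 + 2 * π), ‖dtftCircle ψ (ω : AddCircle (2 * π))‖ₑ ^ 2 =
      ENNReal.ofReal (2 * π) * ‖ψ‖ₑ ^ 2 := by
    rw [AddCircle.lintegral_preimage (2 * π) 0 fun x => ‖dtftCircle ψ x‖ₑ ^ 2,
      AddCircle.volume_eq_smul_haarAddCircle, lintegral_smul_measure, smul_eq_mul, hnorm]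
  rw [← hcircle, zero_add]
  refine lintegral_congr_ae (ae_restrict_of_ae ?_)
  filter_upwards [dtft_ae ψ] with ω h
  rw [h]

section SumEllTwo

variable {A B : Type u} [Fintype A]

lemma enorm_sq_sumEllTwo (Ψ : SumEllTwo A) : ‖Ψ‖ₑ ^ 2 = ∑ a, ‖Ψ a‖ₑ ^ 2 := by
  simp only [← ofReal_norm, ← ENNReal.ofReal_pow (norm_nonneg _), PiLp.norm_sq_eq_of_L2]
  exact ENNReal.ofReal_sum_of_nonneg fun _ _ => by positivity

lemma lintegral_sum_dtft (Ψ : SumEllTwo A) :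
    ∫⁻ ω in Set.Ioc 0 (2 * π), ∑ a, ‖dtft (Ψ a) ω‖ₑ ^ 2 = ENNReal.ofReal (2 * π) * ‖Ψ‖ₑ ^ 2 := by
  rw [lintegral_finsetSum' _ fun a _ =>
    ((AEEqFun.aestronglyMeasurable (dtft (Ψ a))).enorm.pow_const 2).restrict]
  simp only [lintegral_dtft, enorm_sq_sumEllTwo, Finset.mul_sum]

variable [DecidableEq A] [Fintype B]

lemma apply_eq_sum_component (D : SumEllTwo A →L[ℂ] SumEllTwo B) (Ψ : SumEllTwo A) (b : B) :
    D Ψ b = ∑ a, component D b a (Ψ a) := by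
  have hΨ : Ψ = ∑ a, inj a (Ψ a) := by
    ext1 a
    rw [WithLp.ofLp_sum, Finset.sum_apply]
    exact (Fintype.sum_pi_single a Ψ.ofLp).symm
  conv_lhs => rw [hΨ, map_sum, WithLp.ofLp_sum, Finset.sum_apply]
  rfl

lemma IsLSI.dtft_apply {D : SumEllTwo A →L[ℂ] SumEllTwo B} (hD : IsLSI D) (Ψ : SumEllTwo A)
    (b : B) : dtft (D Ψ b) = (hatOf D *ᵥ fun a => dtft (Ψ a)) b := by
  let dtftHom : EllTwo →+ Freq := ⟨⟨dtft, dtft_zero⟩, dtft_add⟩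
  calc dtft (D Ψ b) = ∑ a, dtft (component D b a (Ψ a)) := by
        rw [apply_eq_sum_component]
        exact map_sum dtftHom _ _
    _ = (hatOf D *ᵥ fun a => dtft (Ψ a)) b :=
        Finset.sum_congr rfl fun a _ => LSI.dtft_apply _ (hD b a) _

lemma IsLSI.norm_apply_le {D : SumEllTwo A →L[ℂ] SumEllTwo B} (hD : IsLSI D)
    (h : ∀ᵐ ω : ℝ, IsContraction (evalAt (hatOf D) ω)) (Ψ : SumEllTwo A) : ‖D Ψ‖ ≤ ‖Ψ‖ := by
  have hpoint : ∀ᵐ ω : ℝ, ∑ b, ‖dtft (D Ψ b) ω‖ₑ ^ 2 ≤ ∑ a, ‖dtft (Ψ a) ω‖ₑ ^ 2 := by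
    filter_upwards [sum_norm_sq_mulVec_le h fun a => dtft (Ψ a)] with ω hω
    simp only [← ofReal_norm, ← ENNReal.ofReal_pow (norm_nonneg _), hD.dtft_apply]
    rw [← ENNReal.ofReal_sum_of_nonneg fun _ _ => by positivity,
      ← ENNReal.ofReal_sum_of_nonneg fun _ _ => by positivity]
    exact ENNReal.ofReal_le_ofReal hω
  have hsq := lintegral_mono_ae (ae_restrict_of_ae (s := Set.Ioc 0 (2 * π)) hpoint)
  rw [lintegral_sum_dtft, lintegral_sum_dtft, ENNReal.mul_le_mul_iff_right
    (by simpa using Real.pi_pos) ENNReal.ofReal_ne_top, ENNReal.pow_le_pow_left_iff two_ne_zero]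
    at hsq
  exact enorm_le_iff_norm_le.1 hsq

end SumEllTwo

/-! ### Action on vectors of functions -/

/-- The vector of `Freq^A ⊕ Freq^B` with the given components. -/
def pair {A B : Obj.{u}} (x : A → Freq) (y : B → Freq) : (A ⊗ B : Obj.{u}) → Freq :=
  fun i => Sum.elim x y i

/-- The action of a morphism on vectors of functions of the frequency modulo null sets, in which
the identities that hold for almost every frequency become equalities. -/
def act {A B : Obj.{u}} (f : A ⟶ B) (x : A → Freq) : B → Freq :=
  f.hat *ᵥ x

section Action

variable {A B C D U : Obj.{u}}

@[simp]
lemma pair_inj {x x' : A → Freq} {y y' : B → Freq} :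
    pair x y = pair x' y' ↔ x = x' ∧ y = y' :=
  Sum.elim_eq_iff

lemma exists_eq_pair (z : (A ⊗ B : Obj.{u}) → Freq) : ∃ x y, z = pair x y :=
  ⟨z ∘ Sum.inl, z ∘ Sum.inr, (Sum.elim_comp_inl_inr (α := A) (β := B) z).symm⟩

lemma pair_add (x x' : A → Freq) (y y' : B → Freq) :
    pair (x + x') (y + y') = pair x y + pair x' y' :=
  Sum.elim_add_add ..

lemma pair_sub (x x' : A → Freq) (y y' : B → Freq) :
    pair (x - x') (y - y') = pair x y - pair x' y' :=
  Sum.elim_sub_sub ..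

lemma act_injective : Function.Injective (act : (A ⟶ B) → (A → Freq) → B → Freq) :=
  fun _ _ h => Hom.ext (mulVec_injective h)

lemma act_add (f : A ⟶ B) (x x' : A → Freq) : act f (x + x') = act f x + act f x' :=
  mulVec_add ..

lemma act_sub (f : A ⟶ B) (x x' : A → Freq) : act f (x - x') = act f x - act f x' :=
  mulVec_sub ..

@[simp]
lemma act_comp (f : A ⟶ B) (g : B ⟶ C) (x : A → Freq) : act (f ≫ g) x = act g (act f x) :=
  (mulVec_mulVec ..).symm

lemma act_homOfEquiv (e : A ≃ B) (x : A → Freq) : act (homOfEquiv e) x = x ∘ e.symm := by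
  funext b
  simp [act, mulVec, dotProduct, homOfEquiv_hat, ← Equiv.eq_symm_apply]

@[simp]
lemma act_id (x : A → Freq) : act (𝟙 A) x = x :=
  act_homOfEquiv (Equiv.refl A) x

@[simp]
lemma act_zero (x : A → Freq) : act (zero A B) x = 0 :=
  zero_mulVec x

@[simp]
lemma act_tensorHom (f : A ⟶ C) (g : B ⟶ D) (x : A → Freq) (y : B → Freq) :
    act (f ⊗ₘ g) (pair x y) = pair (act f x) (act g y) := by
  change Matrix.fromBlocks f.hat 0 0 g.hat *ᵥ Sum.elim x y =
    Sum.elim (f.hat *ᵥ x) (g.hat *ᵥ y)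
  simp [fromBlocks_mulVec]

@[simp]
lemma act_whiskerRight (f : A ⟶ C) (x : A → Freq) (y : B → Freq) :
    act (f ▷ B) (pair x y) = pair (act f x) y := by
  rw [← tensorHom_id, act_tensorHom, act_id]

@[simp]
lemma act_whiskerLeft (f : B ⟶ C) (x : A → Freq) (y : B → Freq) :
    act (A ◁ f) (pair x y) = pair x (act f y) := by
  rw [← id_tensorHom, act_tensorHom, act_id]

@[simp]
lemma act_associator_hom (x : A → Freq) (y : B → Freq) (z : C → Freq) :
    act (α_ A B C).hom (pair (pair x y) z) = pair x (pair y z) := by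
  refine (act_homOfEquiv (assocEquiv A B C) _).trans (funext fun i => ?_)
  rcases i with i | i | i <;> rfl

@[simp]
lemma act_associator_inv (x : A → Freq) (y : B → Freq) (z : C → Freq) :
    act (α_ A B C).inv (pair x (pair y z)) = pair (pair x y) z := by
  refine (act_homOfEquiv (assocEquiv A B C).symm _).trans (funext fun i => ?_)
  rcases i with (i | i) | i <;> rfl

@[simp]
lemma act_leftUnitor_hom (x : (𝟙_ Obj.{u}) → Freq) (y : A → Freq) :
    act (λ_ A).hom (pair x y) = y :=
  act_homOfEquiv (leftEquiv A) _

@[simp]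
lemma act_rightUnitor_hom (x : A → Freq) (y : (𝟙_ Obj.{u}) → Freq) :
    act (ρ_ A).hom (pair x y) = x :=
  act_homOfEquiv (rightEquiv A) _

@[simp]
lemma act_leftUnitor_inv (x : A → Freq) : act (λ_ A).inv x = pair 0 x := by
  refine (act_homOfEquiv (leftEquiv A).symm x).trans (funext fun i => ?_)
  rcases i with i | i
  · exact i.elim
  · rfl

@[simp]
lemma act_rightUnitor_inv (x : A → Freq) : act (ρ_ A).inv x = pair x 0 := by
  refine (act_homOfEquiv (rightEquiv A).symm x).trans (funext fun i => ?_)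
  rcases i with i | i
  · rfl
  · exact i.elim

@[simp]
lemma act_braiding_hom (x : A → Freq) (y : B → Freq) :
    act (β_ A B).hom (pair x y) = pair y x := by
  refine (act_homOfEquiv (commEquiv A B) _).trans (funext fun i => ?_)
  rcases i with i | i <;> rfl

@[simp]
lemma act_fst (x : A → Freq) (u : U → Freq) : act (fst A U) (pair x u) = x := by
  simp [fst]

@[simp]
lemma act_snd (x : A → Freq) (u : U → Freq) : act (snd A U) (pair x u) = u := by
  simp [snd]

@[simp]
lemma act_inl (x : A → Freq) : act (inl A U) x = pair x 0 := by
  simp [inl]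

@[simp]
lemma act_inr (u : U → Freq) : act (inr A U) u = pair 0 u := by
  simp [inr]

lemma act_pair (f : A ⊗ U ⟶ B ⊗ U) (x : A → Freq) (u : U → Freq) :
    act f (pair x u) = pair (act (compBA f) x + act (compBU f) u)
      (act (compUA f) x + act (compUU f) u) := by
  have heta (z : (B ⊗ U : Obj.{u}) → Freq) : pair (act (fst B U) z) (act (snd B U) z) = z := by
    obtain ⟨y, u, rfl⟩ := exists_eq_pair z
    simp
  have hsplit : pair x u = pair x 0 + pair 0 u := by simp [← pair_add]
  simp only [compBA, compBU, compUA, compUU, act_comp, act_inl, act_inr, pair_add, heta]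
  rw [← act_add, ← hsplit]

lemma hat_eq_fromBlocks (f : A ⊗ U ⟶ B ⊗ U) :
    f.hat = Matrix.fromBlocks (compBA f).hat (compBU f).hat (compUA f).hat (compUU f).hat := by
  refine mulVec_injective (funext fun z => ?_)
  obtain ⟨x, u, rfl⟩ := exists_eq_pair z
  exact (act_pair f x u).trans (fromBlocks_mulVec _ _ _ _ (Sum.elim x u)).symm

end Action

/-! ### Feedback and execution -/

section Feedback

variable {A A' B B' D E U U' V : Obj.{u}}

/-- The relation between a system `f : A ⊕ U → B ⊕ U` and a morphism `g : A → B`: feeding the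
output `U` of `f` back into its input `U` has, for each input `x`, a solution with output
`g x`. -/
def IsFeedback (f : A ⊗ U ⟶ B ⊗ U) (g : A ⟶ B) : Prop :=
  ∀ x, ∃ u, act f (pair x u) = pair (act g x) u

lemma eq_zero_of_act_pair_zero_eq {f : A ⊗ U ⟶ B ⊗ U} {u : U → Freq} {y : B → Freq}
    (h : act f (pair 0 u) = pair y u) : y = 0 := by
  have hle : ∀ᵐ ω : ℝ, ∑ b, ‖y b ω‖ ^ 2 + ∑ j, ‖u j ω‖ ^ 2 ≤
      ∑ a, ‖(0 : A → Freq) a ω‖ ^ 2 + ∑ j, ‖u j ω‖ ^ 2 := by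
    filter_upwards [sum_norm_sq_mulVec_le f.contraction (pair 0 u)] with ω hω
    change ∑ i, ‖act f (pair 0 u) i ω‖ ^ 2 ≤ _ at hω
    rw [h] at hω
    exact (Fintype.sum_sum_type _).symm.trans_le (hω.trans_eq (Fintype.sum_sum_type _))
  refine funext fun b => AEEqFun.ext ?_
  filter_upwards [hle, AEEqFun.coeFn_zero (α := ℝ) (β := ℂ) (μ := volume)] with ω hω hzero
  have hsum : ∑ b, ‖y b ω‖ ^ 2 ≤ 0 := by simpa [hzero] using hω
  have hb : ‖y b ω‖ ^ 2 ≤ 0 :=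
    (Finset.single_le_sum (f := fun b => ‖y b ω‖ ^ 2) (fun _ _ => by positivity)
      (Finset.mem_univ b)).trans hsum
  simpa [hzero] using hb

lemma eq_of_act_pair_eq {f : A ⊗ U ⟶ B ⊗ U} {x : A → Freq} {u u' : U → Freq} {y y' : B → Freq}
    (h : act f (pair x u) = pair y u) (h' : act f (pair x u') = pair y' u') : y = y' := by
  refine sub_eq_zero.1 (eq_zero_of_act_pair_zero_eq (f := f) (u := u - u') ?_)
  rw [← sub_self x, pair_sub, act_sub, h, h', pair_sub]

lemma IsFeedback.unique {f : A ⊗ U ⟶ B ⊗ U} {g g' : A ⟶ B} (h : IsFeedback f g)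
    (h' : IsFeedback f g') : g = g' := by
  refine act_injective (funext fun x => ?_)
  obtain ⟨u, hu⟩ := h x
  obtain ⟨u', hu'⟩ := h' x
  exact eq_of_act_pair_eq hu hu'

lemma IsFeedback.comp {f : A ⊗ U ⟶ B ⊗ U} {e : A ⟶ B} (h : IsFeedback f e) (g : A' ⟶ A)
    (k : B ⟶ B') : IsFeedback ((g ▷ U) ≫ f ≫ (k ▷ U)) (g ≫ e ≫ k) := fun x => by
  obtain ⟨u, hu⟩ := h (act g x)
  exact ⟨u, by simp [hu]⟩

lemma IsFeedback.slide {f : A ⊗ U ⟶ B ⊗ U'} {g : U' ⟶ U} {e : A ⟶ B}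
    (h : IsFeedback (f ≫ (B ◁ g)) e) : IsFeedback ((A ◁ g) ≫ f) e := fun x => by
  obtain ⟨u, hu⟩ := h x
  obtain ⟨y, u', hf⟩ := exists_eq_pair (act f (pair x u))
  obtain ⟨rfl, rfl⟩ : y = act e x ∧ act g u' = u := by simpa [hf] using hu
  exact ⟨u', by simp [hf]⟩

lemma IsFeedback.tensorHom {f : A ⊗ U ⟶ B ⊗ U} {e : A ⟶ B} (h : IsFeedback f e) (g : D ⟶ E) :
    IsFeedback ((α_ D A U).hom ≫ (g ⊗ₘ f) ≫ (α_ E B U).inv) (g ⊗ₘ e) := fun z => by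
  obtain ⟨w, x, rfl⟩ := exists_eq_pair z
  obtain ⟨u, hu⟩ := h x
  exact ⟨u, by simp [hu]⟩

lemma isFeedback_unit (f : A ⊗ 𝟙_ Obj.{u} ⟶ B ⊗ 𝟙_ Obj.{u}) :
    IsFeedback f ((ρ_ A).inv ≫ f ≫ (ρ_ B).hom) := fun x => by
  obtain ⟨y, u, hf⟩ := exists_eq_pair (act f (pair x 0))
  have hu : u = 0 := funext fun i => i.elim
  exact ⟨0, by simp [hf, hu]⟩

lemma IsFeedback.tensor {f : (A ⊗ U) ⊗ V ⟶ (B ⊗ U) ⊗ V} {g : A ⊗ U ⟶ B ⊗ U} {e : A ⟶ B}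
    (hg : IsFeedback f g) (he : IsFeedback g e) :
    IsFeedback ((α_ A U V).inv ≫ f ≫ (α_ B U V).hom) e := fun x => by
  obtain ⟨u, hu⟩ := he x
  obtain ⟨v, hv⟩ := hg (pair x u)
  exact ⟨pair u v, by simp [hv, hu]⟩

lemma isFeedback_braiding : IsFeedback (β_ U U).hom (𝟙 U) := fun x => ⟨x, by simp⟩

end Feedback

section Execution

variable {A B U : Obj.{u}}

lemma iter_hat (h : U ⟶ U) (n : ℕ) : (iter h n).hat = h.hat ^ n := by
  induction n with
  | zero => exact mulVec_injective (funext fun x => (act_id x).trans (one_mulVec x).symm)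
  | succ n ih => rw [pow_succ', ← ih]; rfl

lemma ae_isContraction_fromBlocks (f : A ⊗ U ⟶ B ⊗ U) :
    ∀ᵐ ω : ℝ, IsContraction (Matrix.fromBlocks (evalAt (compBA f).hat ω)
      (evalAt (compBU f).hat ω) (evalAt (compUA f).hat ω) (evalAt (compUU f).hat ω)) := by
  filter_upwards [f.contraction] with ω h
  rw [hat_eq_fromBlocks] at h
  exact (fromBlocks_map ..) ▸ h

lemma exists_hasSum_pow_mul (f : A ⊗ U ⟶ B ⊗ U) :
    ∃ S : Matrix U A Freq, ∀ᵐ ω : ℝ,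
      HasSum (fun n : ℕ => evalAt (compUU f).hat ω ^ n * evalAt (compUA f).hat ω)
        (evalAt S ω) := by
  have hterm : ∀ᵐ ω : ℝ, ∀ n : ℕ, evalAt ((compUU f).hat ^ n * (compUA f).hat) ω =
      evalAt (compUU f).hat ω ^ n * evalAt (compUA f).hat ω := by
    filter_upwards [evalAt_pow (compUU f).hat,
      ae_all_iff.2 fun n : ℕ => evalAt_mul ((compUU f).hat ^ n) (compUA f).hat]
      with ω hpow hmul n
    rw [hmul, hpow]
  obtain ⟨S, hS⟩ := exists_hasSum_evalAt
    (M := fun n : ℕ => (compUU f).hat ^ n * (compUA f).hat) <| by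
      filter_upwards [ae_isContraction_fromBlocks f, hterm] with ω hf hω
      simpa only [hω] using hf.summable_pow_mul
  refine ⟨S, ?_⟩
  filter_upwards [hS, hterm] with ω h hω
  simpa only [hω] using h

/-- The state `Σ_n f_UU^n f_UA` of the feedback loop of `f`, as a matrix of functions of the
frequency. It need not be bounded, hence is not a morphism `A → U` in general. -/
def loopState (f : A ⊗ U ⟶ B ⊗ U) : Matrix U A Freq :=
  (exists_hasSum_pow_mul f).choose

lemma hasSum_loopState (f : A ⊗ U ⟶ B ⊗ U) :
    ∀ᵐ ω : ℝ, HasSum (fun n : ℕ => evalAt (compUU f).hat ω ^ n * evalAt (compUA f).hat ω)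
      (evalAt (loopState f) ω) :=
  (exists_hasSum_pow_mul f).choose_spec

lemma ae_add_mul_loopState (f : A ⊗ U ⟶ B ⊗ U) :
    ∀ᵐ ω : ℝ, evalAt (compUA f).hat ω + evalAt (compUU f).hat ω * evalAt (loopState f) ω =
      evalAt (loopState f) ω :=
  (hasSum_loopState f).mono fun _ h => add_mul_eq_of_hasSum_pow_mul h

/-- The matrices of the execution formula `f_BA + f_BU (Σ_n f_UU^n f_UA)`. -/
def exHat (f : A ⊗ U ⟶ B ⊗ U) : Matrix B A Freq :=
  (compBA f).hat + (compBU f).hat * loopState f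

lemma evalAt_exHat (f : A ⊗ U ⟶ B ⊗ U) :
    ∀ᵐ ω : ℝ, evalAt (exHat f) ω =
      evalAt (compBA f).hat ω + evalAt (compBU f).hat ω * evalAt (loopState f) ω := by
  filter_upwards [evalAt_add (compBA f).hat ((compBU f).hat * loopState f),
    evalAt_mul (compBU f).hat (loopState f)] with ω hadd hmul
  rw [exHat, hadd, hmul]

lemma ae_isContraction_exHat (f : A ⊗ U ⟶ B ⊗ U) :
    ∀ᵐ ω : ℝ, IsContraction (evalAt (exHat f) ω) := by
  filter_upwards [ae_isContraction_fromBlocks f, ae_add_mul_loopState f, evalAt_exHat f]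
    with ω hf hS hex
  exact hex ▸ hf.feedback hS

lemma evalAt_paths_inr (f : A ⊗ U ⟶ B ⊗ U) :
    ∀ᵐ ω : ℝ, ∀ n, evalAt (paths f (.inr n)).hat ω = evalAt (compBU f).hat ω *
      (evalAt (compUU f).hat ω ^ n * evalAt (compUA f).hat ω) := by
  filter_upwards [evalAt_pow (compUU f).hat,
    ae_all_iff.2 fun n : ℕ => evalAt_mul ((compBU f).hat * (compUU f).hat ^ n) (compUA f).hat,
    ae_all_iff.2 fun n : ℕ => evalAt_mul (compBU f).hat ((compUU f).hat ^ n)]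
    with ω hpow hmul hmul' n
  have hpath : (paths f (.inr n)).hat = (compBU f).hat * (compUU f).hat ^ n * (compUA f).hat := by
    rw [← iter_hat]; rfl
  rw [hpath, hmul, hmul', hpow, Matrix.mul_assoc]

lemma hasSum_paths (f : A ⊗ U ⟶ B ⊗ U) :
    ∀ᵐ ω : ℝ, HasSum (fun i => evalAt (paths f i).hat ω) (evalAt (exHat f) ω) := by
  filter_upwards [hasSum_loopState f, evalAt_paths_inr f, evalAt_exHat f] with ω hS hpaths hex
  rw [hex]
  refine HasSum.sum (hasSum_unique _) ?_
  simp only [Function.comp_def, hpaths]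
  exact hS.map (addMonoidHomMulLeft _) (continuous_const.matrix_mul continuous_id)

/-- The morphism `ex^U(f)`. -/
def ex (A B U : Obj.{u}) (f : A ⊗ U ⟶ B ⊗ U) : A ⟶ B where
  hat := exHat f
  exists_lsi := (exists_lsi_iff _).2 fun b a => by
    refine .of_hasSum (m := fun i => (paths f i).hat b a) (C := 1)
      (fun i => (exists_lsi_iff _).1 (paths f i).exists_lsi b a) ?_ ?_
    · filter_upwards [hasSum_paths f] with ω h
      exact Pi.hasSum.1 (Pi.hasSum.1 h b) a
    · filter_upwards [ae_isContraction_exHat f] with ω h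
      exact h.norm_apply_le_one b a
  contraction := ae_isContraction_exHat f

lemma isSum_paths_ex (f : A ⊗ U ⟶ B ⊗ U) : IsSum (paths f) (ex A B U f) :=
  hasSum_paths f

lemma IsSum.unique {ι : Type v} [Countable ι] {f : ι → (A ⟶ B)} {g g' : A ⟶ B}
    (h : IsSum f g) (h' : IsSum f g') : g = g' :=
  Hom.ext <| eq_of_ae_evalAt_eq <| by filter_upwards [h, h'] with ω hω hω' using hω.unique hω'

lemma isFeedback_ex (f : A ⊗ U ⟶ B ⊗ U) : IsFeedback f (ex A B U f) := fun x => by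
  have hS : (compUA f).hat + (compUU f).hat * loopState f = loopState f :=
    eq_of_ae_evalAt_eq <| by
      filter_upwards [ae_add_mul_loopState f, evalAt_mul (compUU f).hat (loopState f),
        evalAt_add (compUA f).hat ((compUU f).hat * loopState f)] with ω hω hmul hadd
      rw [hadd, hmul, hω]
  refine ⟨loopState f *ᵥ x, ?_⟩
  rw [act_pair, pair_inj]
  simp only [act, mulVec_mulVec, ← add_mulVec, hS, and_true]
  rfl

lemma isTrace_ex : IsTrace ex.{u} where
  naturality g f h := ((isFeedback_ex f).comp g h).unique (isFeedback_ex _)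
  dinaturality f g := (isFeedback_ex (f ≫ (_ ◁ g))).slide.unique (isFeedback_ex _)
  superposing g f := ((isFeedback_ex f).tensorHom g).unique (isFeedback_ex _)
  vanishing_unit f := (isFeedback_ex f).unique (isFeedback_unit f)
  vanishing_tensor f :=
    ((isFeedback_ex f).tensor (isFeedback_ex (ex _ _ _ f))).unique (isFeedback_ex _)
  yanking _ := (isFeedback_ex _).unique isFeedback_braiding

end Execution

end LSI

end

/-- Every `f : A ⊕ U → B ⊕ U` has exactly one sum `ex^U(f)` of the family
`{f_BA} ⊎ {f_BU f_UU^n f_UA}`, these form a trace on `LSI_≤`, and every linear shift invariant map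
represented by `ex^U(f)` is a contraction. -/
theorem mainTheorem1 :
    ∃ ex : ∀ A B U : LSI.Obj.{u}, (A ⊗ U ⟶ B ⊗ U) → (A ⟶ B),
      (∀ (A B U : LSI.Obj.{u}) (f : A ⊗ U ⟶ B ⊗ U) (g : A ⟶ B),
        LSI.IsSum (LSI.paths f) g ↔ g = ex A B U f) ∧
      LSI.IsTrace ex ∧
      (∀ (A B U : LSI.Obj.{u}) (f : A ⊗ U ⟶ B ⊗ U)
        (D : LSI.SumEllTwo A →L[ℂ] LSI.SumEllTwo B),
        LSI.IsLSI D → LSI.hatOf D = (ex A B U f).hat → ∀ Ψ, ‖D Ψ‖ ≤ ‖Ψ‖) := by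
  refine ⟨LSI.ex, fun A B U f g => ⟨fun h => h.unique (LSI.isSum_paths_ex f), ?_⟩,
    LSI.isTrace_ex, fun A B U f D hD hhat => hD.norm_apply_le ?_⟩
  · rintro rfl
    exact LSI.isSum_paths_ex f
  · exact hhat ▸ (LSI.ex A B U f).contraction
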